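/- **Setting.** Let $\mathcal X\subset\mathbb R^n$ be convex and compact, $y_0\in\mathbb R^m$, let $f$ be continuous and $g$ twice continuously differentiable on $\mathcal X\times\mathbb R^m$. Assume that $g$ has a Lipschitz gradient on $\mathcal X\times\mathbb R^m$, that $\nabla^2_{yy}g$ is Lipschitz there with constant $L>0$, that $g\ge\underline g$, and that for every $x\in\mathcal X$ the set $\mathcal S(x)=\{y: g(x,y)\le g(x,y_0)\}$ is compact and contained in a fixed compact set $\mathcal Y$. Let $\overline g_0,\overline f, L_f$ be constants such that $g(x,y_0)\le\overline g_0$ on $\mathcal X$, and $f$ is $L_f$-Lipschitz and $|f|\le\overline f$ on $\{(x,y): x\in\mathcal X,\ y\in\mathcal S(x)\}$. Let $\mathcal Y'$ be compact with $\mathcal Y\subset\operatorname{int}\mathcal Y'$. *Bifurcation set.* Let $\widetilde{\mathcal X}$ be the set of $x\in\mathcal X$ for which $g(x,\cdot)$ has a stationary point $y$ with $\det\nabla^2_{yy}g(x,y)=0$, and let $\widetilde{\mathcal X}_\delta=\{x\in\mathcal X:\operatorname{dist}(x,\widetilde{\mathcal X})\le\delta\}$ (empty if $\widetilde{\mathcal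 X}=\emptyset$). Assume that the upper Minkowski dimension $d=\limsup_{r\to0^+}\frac{\log N(\widetilde{\mathcal X},r)}{-\log r}$ satisfies $d<n$, where $N(A,r)$ is the least number of balls of radius $r$ that cover $A$ (and $d=0$ if $\widetilde{\mathcal X}=\emptyset$). *Lower-level method.* For each $x\in\mathcal X$ let $(y_k(x))_{k\ge0}$ be generated by the cubic-regularized Newton method with parameter $M=L$: $y_0(x)=y_0$ and $y_{k+1}(x)=y_k(x)+s_k$ with $$s_k\in\arg\min_s\Big\{\nabla_yg(x,y_k)^\top s+\tfrac12 s^\top\nabla^2_{yy}g(x,y_k)s+\tfrac M6\|s\|^3\Big\}.$$ The output $\hat y(x)$ after $K$ steps is an iterate $y_k(x)$, $0\le k\le K$, that minimizes $\max\big\{\sqrt{\tfrac1M\|\nabla_yg(x,y_k)\|},\,-\tfrac2{3M}\lambda_{\min}(\nabla^2_{yy}g(x,y_k))\big\}$. Let $\hat S(x)$ be the set of accumulation points of $(y_k(x))_k$ with the smallest value of $g(x,\cdot)$ among all its accumulation points, and let $y^{\rm cd}(x)\in\arg\min_{y\in\hat S(x)}f(x,y)$. Assume that the set of points of $\mathcal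 X\setminus\widetilde{\mathcal X}$ at which $y^{\rm cd}:\mathcal X\to\mathbb R^m$ is discontinuous has Lebesgue measure zero, and that $z\mapsto f(z,\hat y(z))$ is measurable on $\mathcal X$. *Hypergradients.* Let $h_\xi(z)=(2\pi\xi^2)^{-n/2}e^{-\|z\|^2/(2\xi^2)}$ for $\xi>0$. Read $f(z,\cdot)$ as the constant $\overline f$ for $z\notin\mathcal X$, and put $$\phi^{\rm cd}_\xi(x)=\int_{\mathbb R^n}h_\xi(x-z)f(z,y^{\rm cd}(z))\,dz,\qquad \nabla^K_x\phi^{\rm cd}_\xi(x)=\int_{\mathbb R^n}\nabla h_\xi(x-z)f(z,\hat y(z))\,dz .$$ *Requirement on $K$.* Let $\mu(\delta)>0$ and $\alpha(\delta,r)>0$ ($\delta,r>0$) be functions such that, for all $x\in\mathcal X\setminus\widetilde{\mathcal X}_\delta$: every eigenvalue $\lambda$ of $\nabla^2_{yy}g(x,y)$ at any stationary point $y\in\mathcal Y'$ of $g(x,\cdot)$ satisfies $|\lambda|\ge\mu(\delta)$; and $\|\nabla_yg(x,y)\|\ge\alpha(\delta,r)$ for all $y\in\mathcal Y$ at distance more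 than $r$ from the set of stationary points of $g(x,\cdot)$ in $\mathcal Y'$. For $\rho,\delta>0$ require $$K>\max\left\{\frac{256(\overline g_0-\underline g)L^{1/2}}{9\Big(\min\big\{\alpha(\delta,\frac{\mu(\delta)}{2L}),\frac{\mu(\delta)^2}{4L}\big\}\Big)^{3/2}},\ \frac{768(\overline g_0-\underline g)L^2}{\mu(\delta)^3}\right\}+\frac{256(\overline g_0-\underline g)L^{1/2}}{9\big(\frac{\mu(\delta)\rho}2\big)^{3/2}} .\tag{$*$}$$ **Proposition.** Functions $\mu,\alpha$ as above exist. Moreover there are constants $C_1(n,\xi)$ and $C_2(n,\xi)$, which depend only on $\xi$ and on the problem data fixed in the first two paragraphs of the setting (not on $\rho$, $\delta$, $K$, $\mu$, $\alpha$, $x$ or the choices made by the method), such that for all such $\mu,\alpha$, all $\xi,\rho,\delta>0$, every $K$ satisfying $(*)$ and every $x\in\mathbb R^n$, the function $\phi^{\rm cd}_\xi$ is differentiable at $x$, the integral $\nabla^K_x\phi^{\rm cd}_\xi(x)$ converges absolutely, and $$\big\|\nabla_x\phi^{\rm cd}_\xi(x)-\nabla^K_x\phi^{\rm cd}_\xi(x)\big\|\le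 C_1(n,\xi)\,\rho+C_2(n,\xi)\,\delta^{(n-d)/2}.$$ -/

import Mathlib

open Set Filter Topology MeasureTheory
open scoped NNReal

noncomputable section

namespace SmoothedBilevel

/-- `ℝⁿ` with the Euclidean norm. -/
abbrev Vec (n : ℕ) := EuclideanSpace ℝ (Fin n)

variable {n m : ℕ}

/-- Euclidean distance of `(x, y)` and `(x', y')` in `ℝⁿ × ℝᵐ`. -/
def pairDist (x x' : Vec n) (y y' : Vec m) : ℝ :=
  √(‖x - x'‖ ^ 2 + ‖y - y'‖ ^ 2)

/-- The partial gradient `∇_y g(x, y)`. -/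
def gradY (g : Vec n → Vec m → ℝ) (x : Vec n) (y : Vec m) : Vec m :=
  gradient (g x) y

/-- The partial Hessian `∇²_yy g(x, y)`, as an operator on `ℝᵐ`. -/
def hessY (g : Vec n → Vec m → ℝ) (x : Vec n) (y : Vec m) : Vec m →L[ℝ] Vec m :=
  fderiv ℝ (fun v => gradY g x v) y

/-- `g(x, ·)` is a Morse function: each of its stationary points is non-degenerate. -/
def IsMorseAt (g : Vec n → Vec m → ℝ) (x : Vec n) : Prop :=
  ∀ y : Vec m, gradY g x y = 0 → (hessY g x y).det ≠ 0

/-- The bifurcation point set: those `x ∈ 𝒳` for which `g(x, ·)` is not Morse. -/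
def bifurcationSet (g : Vec n → Vec m → ℝ) (X : Set (Vec n)) : Set (Vec n) :=
  {x ∈ X | ¬ IsMorseAt g x}

/-- The points of `𝒳` at distance at most `δ` from the bifurcation set (no point at all if the
bifurcation set is empty, the distance being then infinite). -/
def bifurcationNhd (g : Vec n → Vec m → ℝ) (X : Set (Vec n)) (δ : ℝ) : Set (Vec n) :=
  X ∩ Metric.cthickening δ (bifurcationSet g X)

/-- Smallest number of closed balls of radius `r` needed to cover the bounded set `A`. -/
def coverCount (A : Set (Vec n)) (r : ℝ) : ℕ :=
  (Metric.externalCoveringNumber r.toNNReal A).toNat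

/-- The upper Minkowski dimension of a bounded set (the empty set has dimension `0`). -/
def upperMinkowskiDim (A : Set (Vec n)) : ℝ :=
  limsup (fun r : ℝ => Real.log (coverCount A r) / (-Real.log r)) (𝓝[>] 0)

/-- Standing assumptions on the upper-level objective `f`, the lower-level objective `g`, the
feasible set `X`, the compact set `Y`, the initial point `y₀`, the lower bound `gLow` of `g` and
the Lipschitz constant `L` of `∇²_yy g`. -/
structure StandingAssumptions (f g : Vec n → Vec m → ℝ) (X : Set (Vec n)) (Y : Set (Vec m))
    (y₀ : Vec m) (gLow L : ℝ) : Prop where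
  f_continuous : ContinuousOn (fun p : Vec n × Vec m => f p.1 p.2) (X ×ˢ univ)
  g_contDiff : ContDiffOn ℝ 2 (fun p : Vec n × Vec m => g p.1 p.2) (X ×ˢ univ)
  X_convex : Convex ℝ X
  X_compact : IsCompact X
  /-- `g` has a Lipschitz continuous derivative on `X × ℝᵐ`. -/
  g_lipschitz_smooth : ∃ (G : Vec n × Vec m → (Vec n × Vec m →L[ℝ] ℝ)) (Lg : ℝ≥0),
    (∀ p ∈ X ×ˢ (univ : Set (Vec m)),
      HasFDerivWithinAt (fun p : Vec n × Vec m => g p.1 p.2) (G p) (X ×ˢ univ) p) ∧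
    LipschitzOnWith Lg G (X ×ˢ univ)
  L_pos : 0 < L
  hess_lipschitz : ∀ x ∈ X, ∀ x' ∈ X, ∀ y y' : Vec m,
    ‖hessY g x y - hessY g x' y'‖ ≤ L * pairDist x x' y y'
  g_lower : ∀ x ∈ X, ∀ y, gLow ≤ g x y
  Y_compact : IsCompact Y
  level_compact : ∀ x ∈ X, IsCompact {y | g x y ≤ g x y₀}
  level_subset : ∀ x ∈ X, {y | g x y ≤ g x y₀} ⊆ Y

/-! ### The cubic-regularized Newton method -/

/-- The cubic model of `g(x, ·)` at `y`, as a function of the step `s`. -/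
def cubicModel (M : ℝ) (g : Vec n → Vec m → ℝ) (x : Vec n) (y s : Vec m) : ℝ :=
  inner ℝ (gradY g x y) s + 1 / 2 * inner ℝ s (hessY g x y s) + M / 6 * ‖s‖ ^ 3

/-- `y 0, y 1, …` is a sequence of iterates of the cubic-regularized Newton method for `g(x, ·)`
started at `y₀`: each step is a global minimizer of the cubic model. -/
def IsCubicNewtonRun (M : ℝ) (g : Vec n → Vec m → ℝ) (y₀ : Vec m) (x : Vec n)
    (y : ℕ → Vec m) : Prop :=
  y 0 = y₀ ∧ ∀ (k : ℕ) (s : Vec m),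
    cubicModel M g x (y k) (y (k + 1) - y k) ≤ cubicModel M g x (y k) s

/-- Smallest eigenvalue of a self-adjoint operator, as the minimum of its Rayleigh quotient. -/
def lambdaMin (T : Vec m →L[ℝ] Vec m) : ℝ :=
  ⨅ v : Metric.sphere (0 : Vec m) 1, inner ℝ (T v) (v : Vec m)

/-- The stationarity measure by which the best iterate is selected. -/
def stationarity (M : ℝ) (g : Vec n → Vec m → ℝ) (x : Vec n) (y : Vec m) : ℝ :=
  max √(1 / M * ‖gradY g x y‖) (-(2 / (3 * M)) * lambdaMin (hessY g x y))

/-- `yhat` is the output after `K` steps: an iterate of smallest stationarity measure among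
`y 0, …, y K`. -/
def IsCubicNewtonOutput (M : ℝ) (g : Vec n → Vec m → ℝ) (x : Vec n) (y : ℕ → Vec m) (K : ℕ)
    (yhat : Vec m) : Prop :=
  ∃ k ≤ K, yhat = y k ∧ ∀ j ≤ K, stationarity M g x (y k) ≤ stationarity M g x (y j)

/-! ### The correspondence-driven hyperfunction and its smoothing -/

/-- The accumulation points of the run `y` with smallest lower-level value. -/
def attainableSet (g : Vec n → Vec m → ℝ) (x : Vec n) (y : ℕ → Vec m) : Set (Vec m) :=
  {p | MapClusterPt p atTop y ∧ ∀ q, MapClusterPt q atTop y → g x p ≤ g x q}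

/-- `p` minimizes `f(x, ·)` over the attainable set. -/
def IsCorrespondenceSolution (f g : Vec n → Vec m → ℝ) (x : Vec n) (y : ℕ → Vec m)
    (p : Vec m) : Prop :=
  p ∈ attainableSet g x y ∧ ∀ q ∈ attainableSet g x y, f x p ≤ f x q

open Classical in
/-- The function `z ↦ f(z, w(z))` on `X`, extended by the constant `fBar` outside `X`. -/
def extendedValue (f : Vec n → Vec m → ℝ) (X : Set (Vec n)) (fBar : ℝ) (w : Vec n → Vec m)
    (z : Vec n) : ℝ :=
  if z ∈ X then f z (w z) else fBar

/-- The Gaussian kernel `h_ξ` on `ℝⁿ`. -/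
def gaussKernel (ξ : ℝ) (z : Vec n) : ℝ :=
  1 / (2 * Real.pi * ξ ^ 2) ^ ((n : ℝ) / 2) * Real.exp (-‖z‖ ^ 2 / (2 * ξ ^ 2))

/-- The convolution `x ↦ ∫ h_ξ(x - z) φ(z) dz`. -/
def gaussSmooth (ξ : ℝ) (φ : Vec n → ℝ) (x : Vec n) : ℝ :=
  ∫ z, gaussKernel ξ (x - z) * φ z

/-- `∫ ∇h_ξ(x - z) φ(z) dz`. -/
def kernelGradIntegral (ξ : ℝ) (φ : Vec n → ℝ) (x : Vec n) : Vec n :=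
  ∫ z, φ z • gradient (gaussKernel ξ) (x - z)

/-! ### The requirement on the number of iterations -/

/-- `μ(δ) > 0` bounds from below the absolute value of the Hessian eigenvalues at all stationary
points in `Y'`, for all `x ∈ X` at distance more than `δ` from the bifurcation set. -/
def IsEigenvalueBound (g : Vec n → Vec m → ℝ) (X : Set (Vec n)) (Y' : Set (Vec m))
    (μ : ℝ → ℝ) : Prop :=
  ∀ δ > 0, 0 < μ δ ∧ ∀ x ∈ X \ bifurcationNhd g X δ, ∀ y ∈ Y', gradY g x y = 0 →
    ∀ l : ℝ, Module.End.HasEigenvalue (hessY g x y : Vec m →ₗ[ℝ] Vec m) l → μ δ ≤ |l|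

/-- The stationary points of `g(x, ·)` in `Y'`. -/
def critSet (g : Vec n → Vec m → ℝ) (Y' : Set (Vec m)) (x : Vec n) : Set (Vec m) :=
  {y ∈ Y' | gradY g x y = 0}

/-- `α(δ, r) > 0` bounds `‖∇_y g(x, y)‖` from below, for all `x ∈ X` at distance more than `δ`
from the bifurcation set and all `y ∈ Y` at distance more than `r` from the stationary points
in `Y'`. -/
def IsGradientBound (g : Vec n → Vec m → ℝ) (X : Set (Vec n)) (Y Y' : Set (Vec m))
    (α : ℝ → ℝ → ℝ) : Prop :=
  ∀ δ > 0, ∀ r > 0, 0 < α δ r ∧ ∀ x ∈ X \ bifurcationNhd g X δ,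
    ∀ y ∈ Y \ Metric.cthickening r (critSet g Y' x), α δ r ≤ ‖gradY g x y‖

/-- The first part `K₁` of the iteration requirement, for the values `μ = μ(δ)` and
`a = α(δ, μ(δ) / (2 L))`. -/
def iterBound₁ (gBar gLow L μ a : ℝ) : ℝ :=
  max (256 * (gBar - gLow) * L ^ ((1 : ℝ) / 2) / (9 * (min a (μ ^ 2 / (4 * L))) ^ ((3 : ℝ) / 2)))
    (768 * (gBar - gLow) * L ^ 2 / μ ^ 3)

/-- The second part `K₂` of the iteration requirement, for the value `μ = μ(δ)`. -/
def iterBound₂ (gBar gLow L μ ρ : ℝ) : ℝ :=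
  256 * (gBar - gLow) * L ^ ((1 : ℝ) / 2) / (9 * (μ * ρ / 2) ^ ((3 : ℝ) / 2))

end SmoothedBilevel

end

/-!
Away from the `δ`-neighbourhood of the bifurcation set, compactness and the inverse function theorem
make all stationary points of `g(x, ·)` uniformly non-degenerate. Each cubic step `s` decreases
`g(x, ·)` by at least `L/12 ‖s‖³`, while the stationarity measure of the next iterate is at most
`‖s‖`; telescoping, the output is almost stationary up to second order. It therefore lies near a
non-degenerate stationary point, which must be a strict local minimizer, and inside the region where
the run contracts. So the run converges to that minimizer, its only accumulation point, which lies
within `ρ` of the output.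

On the `δ`-neighbourhood only the bound on `f` is used: since the bifurcation set is covered by at
most `r ^ (-(n + d) / 2)` balls of small radius `r`, the volume is `O(δ ^ ((n - d) / 2))`. In
particular the bifurcation set is a null set, hence `y^cd` is almost everywhere continuous.
Integrating both estimates against `∇h_ξ` gives the claim.
-/

namespace SmoothedBilevel

section Covering

variable {E : Type*} [NormedAddCommGroup E]

theorem externalCoveringNumber_ne_top [ProperSpace E] {A : Set E}
    (hA : Bornology.IsBounded A) {r : ℝ≥0} (hr : r ≠ 0) :
    Metric.externalCoveringNumber r A ≠ ⊤ := by
  obtain ⟨N, -, hN, hcov⟩ :=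
    Metric.exists_finite_isCover_of_isCompact_closure hr hA.isCompact_closure
  exact (hcov.externalCoveringNumber_le_encard.trans_lt hN.encard_lt_top).ne

variable [MeasurableSpace E] [BorelSpace E] (μ : Measure E) [μ.IsAddHaarMeasure]

theorem encard_mul_measure_ball_le {r : ℝ≥0}
    {C : Set E} (hC : Metric.IsSeparated r C) :
    C.encard * μ (Metric.ball 0 (r / 2)) ≤ μ (Metric.thickening (r / 2) C) := by
  have hdisj : Pairwise (Function.onFun Disjoint fun c : C => Metric.ball (c : E) (r / 2)) := by
    intro a b hab
    have hsep : (r : ENNReal) < edist (a : E) b := hC a.2 b.2 (Subtype.coe_ne_coe.2 hab)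
    rw [edist_dist, ← ENNReal.ofReal_coe_nnreal,
      ENNReal.ofReal_lt_ofReal_iff_of_nonneg r.coe_nonneg] at hsep
    exact Metric.ball_disjoint_ball (by linarith)
  calc C.encard * μ (Metric.ball 0 (r / 2))
      = ∑' c : C, μ (Metric.ball (c : E) (r / 2)) := by
        simp only [Measure.addHaar_ball_center, ENNReal.tsum_const, Set.encard]
    _ ≤ μ (⋃ c : C, Metric.ball (c : E) (r / 2)) :=
        tsum_meas_le_meas_iUnion_of_disjoint μ (fun _ => measurableSet_ball) hdisj
    _ = μ (Metric.thickening (r / 2) C) := by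
        rw [Metric.thickening_eq_biUnion_ball, iUnion_coe_set]

theorem measure_cthickening_le_encard_mul {r : ℝ≥0} (hr : 0 < r) {A C : Set E}
    (hC : Metric.IsCover r A C) :
    μ (Metric.cthickening r A) ≤ C.encard * μ (Metric.closedBall 0 (3 * r)) := by
  have : (0 : ℝ) < r := hr
  rcases C.finite_or_infinite with hfin | hinf
  · have hsub : Metric.cthickening r A ⊆ ⋃ c ∈ C, Metric.closedBall c (3 * r) := by
      intro x hx
      obtain ⟨a, ha, hxa⟩ := Metric.mem_thickening_iff.1 <|
        Metric.cthickening_subset_thickening' (by positivity) (by linarith : (r : ℝ) < 2 * r) A hx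
      obtain ⟨c, hc, hac⟩ := mem_iUnion₂.1 (Metric.isCover_iff_subset_iUnion_closedBall.1 hC ha)
      refine mem_iUnion₂.2 ⟨c, hc, (dist_triangle x a c).trans ?_⟩
      linarith [Metric.mem_closedBall.1 hac]
    calc μ (Metric.cthickening r A) ≤ ∑' c : C, μ (Metric.closedBall (c : E) (3 * r)) :=
          (measure_mono hsub).trans (measure_biUnion_le μ hfin.countable _)
      _ = C.encard * μ (Metric.closedBall 0 (3 * r)) := by
          simp only [Measure.addHaar_closedBall_center, ENNReal.tsum_const, Set.encard]
  · rw [hinf.encard_eq, ENat.toENNReal_top,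
      ENNReal.top_mul (Metric.measure_closedBall_pos μ 0 (by positivity)).ne']
    exact le_top

theorem externalCoveringNumber_mul_measure_ball_le [ProperSpace E] {A : Set E}
    (hA : Bornology.IsBounded A) {r : ℝ≥0} (hr : r ≠ 0) :
    Metric.externalCoveringNumber r A * μ (Metric.ball 0 (r / 2)) ≤
      μ (Metric.thickening (r / 2) A) := by
  have hfin : Metric.packingNumber r A ≠ ⊤ := by
    rw [← mul_div_cancel₀ r (two_ne_zero' ℝ≥0)]
    exact ne_top_of_le_ne_top (externalCoveringNumber_ne_top hA (by positivity))
      (Metric.packingNumber_two_mul_le_externalCoveringNumber (r / 2) A)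
  obtain ⟨C, hCA, -, hC, hcard⟩ := Metric.exists_set_encard_eq_packingNumber hfin
  calc Metric.externalCoveringNumber r A * μ (Metric.ball 0 (r / 2))
      ≤ C.encard * μ (Metric.ball 0 (r / 2)) := by
        gcongr
        rw [hcard]
        exact (Metric.externalCoveringNumber_le_coveringNumber r A).trans
          (Metric.coveringNumber_le_packingNumber r A)
    _ ≤ μ (Metric.thickening (r / 2) C) := encard_mul_measure_ball_le μ hC
    _ ≤ μ (Metric.thickening (r / 2) A) :=
        measure_mono (Metric.thickening_subset_of_subset _ hCA)

theorem measure_cthickening_le {r : ℝ≥0} (hr : 0 < r) (A : Set E) :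
    μ (Metric.cthickening r A) ≤
      Metric.externalCoveringNumber r A * μ (Metric.closedBall 0 (3 * r)) := by
  have : Nonempty {C : Set E // Metric.IsCover r A C} := ⟨⟨A, Metric.IsCover.rfl⟩⟩
  obtain ⟨⟨C, hC⟩, hcard⟩ :=
    ENat.exists_eq_iInf fun C : {C : Set E // Metric.IsCover r A C} => C.1.encard
  rw [Metric.externalCoveringNumber, iInf_subtype', ← hcard]
  exact measure_cthickening_le_encard_mul μ hr hC

end Covering

section MinkowskiDimension

variable {n : ℕ} {A B : Set (Vec n)}

theorem coverCount_toENNReal (hA : Bornology.IsBounded A) {r : ℝ} (hr : 0 < r) :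
    (coverCount A r : ENNReal) = Metric.externalCoveringNumber r.toNNReal A := by
  rw [coverCount, ← ENat.toENNReal_coe, ENat.natCast_toNat]
  exact externalCoveringNumber_ne_top hA (Real.toNNReal_pos.2 hr).ne'

theorem coverCount_le {R r : ℝ} (hr : 0 < r) (hR : 0 ≤ R) (hA : A ⊆ Metric.closedBall 0 R) :
    (coverCount A r : ℝ) ≤ ((2 * R + r) / r) ^ n := by
  have hbdd : Bornology.IsBounded A := Metric.isBounded_closedBall.subset hA
  have hvol : coverCount A r * volume (Metric.ball (0 : Vec n) (r / 2)) ≤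
      volume (Metric.closedBall (0 : Vec n) (r / 2 + R)) := by
    have h := externalCoveringNumber_mul_measure_ball_le volume hbdd (Real.toNNReal_pos.2 hr).ne'
    rw [← coverCount_toENNReal hbdd hr, Real.coe_toNNReal _ hr.le] at h
    refine h.trans (measure_mono ?_)
    exact (Metric.thickening_subset_cthickening _ _).trans <|
      (Metric.cthickening_subset_of_subset _ hA).trans
        (cthickening_closedBall (by positivity) hR 0).subset
  have hreal := ENNReal.toReal_mono measure_closedBall_lt_top.ne hvol
  rw [Measure.addHaar_ball_of_pos volume _ (by positivity),
    Measure.addHaar_closedBall volume _ (by positivity), ENNReal.toReal_mul, ENNReal.toReal_mul,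
    ENNReal.toReal_mul, ENNReal.toReal_natCast, ENNReal.toReal_ofReal (by positivity),
    ENNReal.toReal_ofReal (by positivity), ← mul_assoc, finrank_euclideanSpace_fin] at hreal
  have hunit : 0 < (volume (Metric.ball (0 : Vec n) 1)).toReal :=
    ENNReal.toReal_pos (Metric.measure_ball_pos _ _ one_pos).ne' measure_ball_lt_top.ne
  calc (coverCount A r : ℝ) ≤ (r / 2 + R) ^ n / (r / 2) ^ n :=
        (le_div_iff₀ (by positivity)).2 (le_of_mul_le_mul_right hreal hunit)
    _ = ((2 * R + r) / r) ^ n := by rw [← div_pow]; congr 1; field_simp; ring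

theorem volume_cthickening_le (hA : Bornology.IsBounded A) {r : ℝ} (hr : 0 < r) :
    volume.real (Metric.cthickening r A) ≤
      coverCount A r * ((3 * r) ^ n * volume.real (Metric.ball (0 : Vec n) 1)) := by
  have h := measure_cthickening_le volume (Real.toNNReal_pos.2 hr) A
  rw [← coverCount_toENNReal hA hr, Real.coe_toNNReal _ hr.le] at h
  have hreal := ENNReal.toReal_mono
    (ENNReal.mul_ne_top (ENNReal.natCast_ne_top _) measure_closedBall_lt_top.ne) h
  rwa [ENNReal.toReal_mul, ENNReal.toReal_natCast, ← measureReal_def, ← measureReal_def,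
    Measure.addHaar_real_closedBall volume _ (by positivity), finrank_euclideanSpace_fin] at hreal

theorem log_coverCount_div_le {R r : ℝ} (hR : 0 ≤ R) (hA : A ⊆ Metric.closedBall 0 R)
    (hr : 0 < r) (hr1 : r < 1) (hrR : r * (2 * R + 1) ≤ 1) :
    Real.log (coverCount A r) / (-Real.log r) ≤ 2 * n := by
  rw [div_le_iff₀ (neg_pos.2 (Real.log_neg hr hr1))]
  rcases (coverCount A r).eq_zero_or_pos with hzero | hpos
  · rw [hzero, Nat.cast_zero, Real.log_zero]
    exact mul_nonneg (by positivity) (neg_nonneg.2 (Real.log_nonpos hr.le hr1.le))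
  have hbase : (2 * R + r) / r ≤ r⁻¹ ^ 2 := by
    rw [inv_pow, ← one_div, div_le_div_iff₀ hr (by positivity)]
    nlinarith
  calc Real.log (coverCount A r) ≤ Real.log ((r⁻¹ ^ 2) ^ n) := by
        refine Real.log_le_log (by exact_mod_cast hpos) ((coverCount_le hr hR hA).trans ?_)
        gcongr
    _ = 2 * n * -Real.log r := by
        rw [← pow_mul, Real.log_pow, Real.log_inv]
        push_cast
        ring

theorem eventually_coverCount_le (hA : Bornology.IsBounded A) {e : ℝ}
    (he : upperMinkowskiDim A < e) : ∀ᶠ r in 𝓝[>] 0, (coverCount A r : ℝ) ≤ r ^ (-e) := by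
  obtain ⟨R, hR, hAR⟩ := hA.subset_closedBall_lt 0 0
  have hsmall : ∀ᶠ r : ℝ in 𝓝[>] 0, 0 < r ∧ r < 1 ∧ r * (2 * R + 1) ≤ 1 := by
    filter_upwards [Ioo_mem_nhdsGT (show (0 : ℝ) < 1 / (2 * R + 1) by positivity)] with r hr
    have h := (lt_div_iff₀ (by positivity)).1 hr.2
    exact ⟨hr.1, by nlinarith [hr.1], h.le⟩
  have hbdd : IsBoundedUnder (· ≤ ·) (𝓝[>] (0 : ℝ))
      fun r : ℝ => Real.log (coverCount A r) / (-Real.log r) :=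
    isBoundedUnder_of_eventually_le (a := 2 * (n : ℝ)) <| hsmall.mono fun r hr =>
      log_coverCount_div_le hR.le hAR hr.1 hr.2.1 hr.2.2
  filter_upwards [eventually_lt_of_limsup_lt he hbdd, hsmall] with r hlog ⟨hr, hr1, _⟩
  rw [div_lt_iff₀ (neg_pos.2 (Real.log_neg hr hr1))] at hlog
  rcases (coverCount A r).eq_zero_or_pos with hzero | hpos
  · rw [hzero, Nat.cast_zero]
    positivity
  rw [Real.rpow_def_of_pos hr, ← Real.log_le_iff_le_exp (by exact_mod_cast hpos)]
  linarith

theorem eventually_volume_cthickening_le (hA : Bornology.IsBounded A) {e : ℝ}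
    (he : upperMinkowskiDim A < e) : ∀ᶠ r in 𝓝[>] 0, volume.real (Metric.cthickening r A) ≤
      3 ^ n * volume.real (Metric.ball (0 : Vec n) 1) * r ^ (n - e) := by
  filter_upwards [eventually_coverCount_le hA he, self_mem_nhdsWithin] with r hcount hr
  replace hr : 0 < r := hr
  calc volume.real (Metric.cthickening r A)
      ≤ r ^ (-e) * ((3 * r) ^ n * volume.real (Metric.ball (0 : Vec n) 1)) :=
        (volume_cthickening_le hA hr).trans (by gcongr)
    _ = 3 ^ n * volume.real (Metric.ball (0 : Vec n) 1) * r ^ (n - e) := by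
        rw [mul_pow, ← Real.rpow_natCast r n, sub_eq_neg_add, Real.rpow_add hr]
        ring

theorem exists_forall_le_mul_rpow_of_eventually {u : ℝ → ℝ} {M c p : ℝ} (hp : 0 ≤ p)
    (hM : ∀ r > 0, u r ≤ M) (hu : ∀ᶠ r in 𝓝[>] 0, u r ≤ c * r ^ p) :
    ∃ C, ∀ r > 0, u r ≤ C * r ^ p := by
  obtain ⟨r₀, hr₀, hsub⟩ := mem_nhdsGT_iff_exists_Ioo_subset.1 hu
  replace hr₀ : 0 < r₀ := hr₀
  refine ⟨max c (|M| / r₀ ^ p), fun r hr => ?_⟩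
  rcases lt_or_ge r r₀ with hlt | hge
  · exact (show u r ≤ c * r ^ p from hsub ⟨hr, hlt⟩).trans (by gcongr; exact le_max_left _ _)
  · calc u r ≤ |M| := (hM r hr).trans (le_abs_self M)
      _ = |M| / r₀ ^ p * r₀ ^ p := by field_simp
      _ ≤ max c (|M| / r₀ ^ p) * r ^ p := by gcongr; exact le_max_right _ _

theorem exists_volume_inter_cthickening_le (hA : Bornology.IsBounded A)
    (hB : Bornology.IsBounded B) (hd : upperMinkowskiDim A < n) :
    ∃ C, ∀ δ > 0, volume.real (B ∩ Metric.cthickening δ A) ≤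
      C * δ ^ ((n - upperMinkowskiDim A) / 2) := by
  have hsmall := eventually_volume_cthickening_le hA
    (e := (n + upperMinkowskiDim A) / 2) (by linarith)
  rw [show (n : ℝ) - (n + upperMinkowskiDim A) / 2 = (n - upperMinkowskiDim A) / 2 by ring]
    at hsmall
  exact exists_forall_le_mul_rpow_of_eventually (by linarith)
    (fun δ _ => measureReal_mono inter_subset_left hB.measure_lt_top.ne) <|
    hsmall.mono fun δ hδ =>
      (measureReal_mono inter_subset_right hA.cthickening.measure_lt_top.ne).trans hδ

theorem volume_eq_zero_of_upperMinkowskiDim_lt (hA : Bornology.IsBounded A)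
    (hd : upperMinkowskiDim A < n) : volume A = 0 := by
  obtain ⟨e, hde, hen⟩ := exists_between hd
  set c := 3 ^ n * volume.real (Metric.ball (0 : Vec n) 1)
  have hlim : Tendsto (fun r : ℝ => c * r ^ (n - e)) (𝓝[>] 0) (𝓝 0) := by
    have h := ((Real.continuousAt_rpow_const 0 (n - e) (Or.inr (by linarith))).const_mul c).tendsto
    rw [Real.zero_rpow (by linarith), mul_zero] at h
    exact h.mono_left nhdsWithin_le_nhds
  have hle : volume.real A ≤ 0 := by
    refine ge_of_tendsto hlim ((eventually_volume_cthickening_le hA hde).mono fun r hr => ?_)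
    exact (measureReal_mono (Metric.self_subset_cthickening A)
      hA.cthickening.measure_lt_top.ne).trans hr
  exact (measureReal_eq_zero_iff hA.measure_lt_top.ne).1 (le_antisymm hle measureReal_nonneg)

end MinkowskiDimension

section Taylor

variable {E F : Type*} [NormedAddCommGroup E]

theorem hasDerivAt_add_smul [NormedSpace ℝ E] (y s : E) (t : ℝ) :
    HasDerivAt (fun t : ℝ => y + t • s) s t := by
  simpa using ((hasDerivAt_id t).smul_const s).const_add y

theorem norm_sub_linear_le [NormedSpace ℝ E] [NormedAddCommGroup F] [NormedSpace ℝ F]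
    {G : E → F} {H : E → E →L[ℝ] F} {L : ℝ} (hH : ∀ y, HasFDerivAt G (H y) y)
    (hL : ∀ y y', ‖H y - H y'‖ ≤ L * ‖y - y'‖) (y s : E) :
    ‖G (y + s) - G y - H y s‖ ≤ L / 2 * ‖s‖ ^ 2 := by
  have hderiv (t : ℝ) : HasDerivAt (fun t : ℝ => G (y + t • s) - G y - t • H y s)
      (H (y + t • s) s - H y s) t := by
    have hcomp := (hH (y + t • s)).comp_hasDerivAt t (hasDerivAt_add_smul y s t)
    refine ((hcomp.sub_const (G y)).sub ((hasDerivAt_id t).smul_const (H y s))).congr_deriv ?_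
    rw [one_smul]
  have hbound (t : ℝ) :
      HasDerivAt (fun t : ℝ => L / 2 * ‖s‖ ^ 2 * t ^ 2) (L * t * ‖s‖ ^ 2) t := by
    refine ((hasDerivAt_pow 2 t).const_mul (L / 2 * ‖s‖ ^ 2)).congr_deriv ?_
    push_cast
    ring
  have hle (t : ℝ) (ht : t ∈ Ico (0 : ℝ) 1) : ‖H (y + t • s) s - H y s‖ ≤ L * t * ‖s‖ ^ 2 := by
    calc ‖H (y + t • s) s - H y s‖ ≤ ‖H (y + t • s) - H y‖ * ‖s‖ :=
          (H (y + t • s) - H y).le_opNorm s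
      _ ≤ L * ‖y + t • s - y‖ * ‖s‖ := by gcongr; exact hL _ _
      _ = L * t * ‖s‖ ^ 2 := by
          rw [add_sub_cancel_left, norm_smul, Real.norm_of_nonneg ht.1]
          ring
  have h := image_norm_le_of_norm_deriv_right_le_deriv_boundary (a := 0) (b := 1)
    (fun t _ => (hderiv t).continuousAt.continuousWithinAt)
    (fun t _ => (hderiv t).hasDerivWithinAt) (by simp) hbound hle (right_mem_Icc.2 zero_le_one)
  simpa using h

theorem abs_sub_quadratic_le [InnerProductSpace ℝ E] [CompleteSpace E]
    {h : E → ℝ} {G : E → E} {H : E → E →L[ℝ] E} {L : ℝ} (hG : ∀ y, HasGradientAt h (G y) y)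
    (hH : ∀ y, HasFDerivAt G (H y) y) (hL : ∀ y y', ‖H y - H y'‖ ≤ L * ‖y - y'‖) (y s : E) :
    |h (y + s) - h y - inner ℝ (G y) s - 1 / 2 * inner ℝ s (H y s)| ≤ L / 6 * ‖s‖ ^ 3 := by
  have hderiv (t : ℝ) : HasDerivAt
      (fun t : ℝ => h (y + t • s) - h y - t * inner ℝ (G y) s - t ^ 2 * (1 / 2 * inner ℝ s (H y s)))
      (inner ℝ (G (y + t • s) - G y - H y (t • s)) s) t := by
    have hcomp := (hG (y + t • s)).hasFDerivAt.comp_hasDerivAt t (hasDerivAt_add_smul y s t)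
    refine (((hcomp.sub_const (h y)).sub ((hasDerivAt_id t).mul_const (inner ℝ (G y) s))).sub
      ((hasDerivAt_pow 2 t).mul_const (1 / 2 * inner ℝ s (H y s)))).congr_deriv ?_
    simp only [InnerProductSpace.toDual_apply_apply, inner_sub_left, map_smul, inner_smul_left,
      real_inner_comm s (H y s), conj_trivial]
    push_cast
    ring
  have hbound (t : ℝ) :
      HasDerivAt (fun t : ℝ => L / 6 * ‖s‖ ^ 3 * t ^ 3) (L / 2 * t ^ 2 * ‖s‖ ^ 3) t := by
    refine ((hasDerivAt_pow 3 t).const_mul (L / 6 * ‖s‖ ^ 3)).congr_deriv ?_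
    push_cast
    ring
  have hle (t : ℝ) (ht : t ∈ Ico (0 : ℝ) 1) :
      ‖inner ℝ (G (y + t • s) - G y - H y (t • s)) s‖ ≤ L / 2 * t ^ 2 * ‖s‖ ^ 3 := by
    calc ‖inner ℝ (G (y + t • s) - G y - H y (t • s)) s‖
        ≤ ‖G (y + t • s) - G y - H y (t • s)‖ * ‖s‖ := norm_inner_le_norm _ _
      _ ≤ L / 2 * ‖t • s‖ ^ 2 * ‖s‖ := by gcongr; exact norm_sub_linear_le hH hL y (t • s)
      _ = L / 2 * t ^ 2 * ‖s‖ ^ 3 := by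
          rw [norm_smul, Real.norm_of_nonneg ht.1]
          ring
  have hmain := image_norm_le_of_norm_deriv_right_le_deriv_boundary (a := 0) (b := 1)
    (fun t _ => (hderiv t).continuousAt.continuousWithinAt)
    (fun t _ => (hderiv t).hasDerivWithinAt) (by simp) hbound hle (right_mem_Icc.2 zero_le_one)
  simpa only [one_smul, one_mul, one_pow, mul_one, Real.norm_eq_abs] using hmain

end Taylor

section CubicStep

variable {E : Type*} [NormedAddCommGroup E] [InnerProductSpace ℝ E]
  {M : ℝ} {b s : E} {A : E →L[ℝ] E}

/-- The cubic-regularized quadratic form with gradient `b`, Hessian `A` and parameter `M`; the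
cubic model of `g(x, ·)` at `y` is the case `b = ∇_y g(x, y)`, `A = ∇²_yy g(x, y)`. -/
noncomputable def cubicForm (M : ℝ) (b : E) (A : E →L[ℝ] E) (s : E) : ℝ :=
  inner ℝ b s + 1 / 2 * inner ℝ s (A s) + M / 6 * ‖s‖ ^ 3

/-- `s` is a step of the cubic-regularized Newton method: a global minimizer of `cubicForm`. -/
def IsCubicStep (M : ℝ) (b : E) (A : E →L[ℝ] E) (s : E) : Prop :=
  ∀ s', cubicForm M b A s ≤ cubicForm M b A s'

theorem hasFDerivAt_cubicForm (hA : A.IsSymmetric) (s : E) :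
    HasFDerivAt (cubicForm M b A) (innerSL ℝ (b + A s + (M / 2 * ‖s‖) • s)) s := by
  have hnorm : HasFDerivAt (fun s : E => ‖s‖ ^ 3) ((3 * ‖s‖) • innerSL ℝ s) s := by
    have h := hasFDerivAt_norm_rpow s (p := 3) (by norm_num)
    norm_num at h
    exact h
  have hlin : HasFDerivAt (fun s => inner ℝ b s) (innerSL ℝ b) s := (innerSL ℝ b).hasFDerivAt
  have hquad := (hasFDerivAt_id (𝕜 := ℝ) s).inner ℝ A.hasFDerivAt
  refine ((hlin.add (hquad.const_mul (1 / 2))).add (hnorm.const_mul (M / 6))).congr_fderiv ?_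
  ext v
  have hsym : inner ℝ (A s) v = inner ℝ s (A v) := hA s v
  simp only [one_div, id_eq, add_apply, coe_innerSL_apply, smul_apply,
    ContinuousLinearMap.comp_apply, ContinuousLinearMap.prod_apply, ContinuousLinearMap.id_apply,
    fderivInnerCLM_apply, real_inner_comm (A s) v, hsym, smul_eq_mul, map_add, map_smul]
  ring

namespace IsCubicStep

theorem first_order (h : IsCubicStep M b A s) (hA : A.IsSymmetric) :
    b + A s + (M / 2 * ‖s‖) • s = 0 := by
  have hzero := IsLocalMin.hasFDerivAt_eq_zero (Eventually.of_forall h) (hasFDerivAt_cubicForm hA s)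
  exact inner_self_eq_zero.1 (DFunLike.congr_fun hzero _)

theorem inner_first_order (h : IsCubicStep M b A s) (hA : A.IsSymmetric) :
    inner ℝ b s + inner ℝ s (A s) + M / 2 * ‖s‖ ^ 3 = 0 := by
  have hinner := congrArg (fun w => inner ℝ w s) (h.first_order hA)
  simp only [inner_add_left, inner_smul_left, inner_zero_left, conj_trivial,
    real_inner_self_eq_norm_sq] at hinner
  rw [real_inner_comm (A s) s]
  linarith

theorem cubicForm_le (h : IsCubicStep M b A s) (hA : A.IsSymmetric) :
    cubicForm M b A s ≤ -(M / 12 * ‖s‖ ^ 3) := by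
  have hfirst := h.inner_first_order hA
  have hneg := h (-s)
  simp only [cubicForm, inner_neg_right, map_neg, norm_neg, inner_neg_left] at hneg ⊢
  linarith

theorem second_order_of_norm_eq (h : IsCubicStep M b A s) (hA : A.IsSymmetric) {s' : E}
    (hs : ‖s'‖ = ‖s‖) : 0 ≤ inner ℝ (s' - s) (A (s' - s)) + M / 2 * ‖s‖ * ‖s' - s‖ ^ 2 := by
  have hmin := h s'
  have hb : b = -(A s) - (M / 2 * ‖s‖) • s := by
    rw [← sub_eq_zero, ← h.first_order hA]
    abel
  have hsym : inner ℝ (A s) s' = inner ℝ s (A s') := hA s s'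
  have hself : inner ℝ (A s) s = inner ℝ s (A s) := hA s s
  have hswap : inner ℝ s' (A s) = inner ℝ s (A s') := by rw [real_inner_comm, hsym]
  simp only [cubicForm, hs, hb, inner_sub_left, inner_neg_left, inner_smul_left, conj_trivial,
    real_inner_self_eq_norm_sq, hsym, hself] at hmin
  rw [← real_inner_self_eq_norm_sq (s' - s)]
  simp only [inner_sub_left, inner_sub_right, map_sub, real_inner_self_eq_norm_sq, hs, hswap,
    real_inner_comm s s']
  linear_combination 2 * hmin

theorem second_order_of_inner_ne_zero (h : IsCubicStep M b A s) (hA : A.IsSymmetric) {v : E}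
    (hv : inner ℝ s v ≠ 0) : 0 ≤ inner ℝ v (A v) + M / 2 * ‖s‖ * ‖v‖ ^ 2 := by
  have hv₀ : v ≠ 0 := by
    rintro rfl
    exact hv (inner_zero_right s)
  -- `s + c • v` is the second point of the line `s + ℝ v` on the sphere through `s`.
  obtain ⟨c, hc⟩ : ∃ c, c = -(2 * inner ℝ s v / ‖v‖ ^ 2) := ⟨_, rfl⟩
  have hc₀ : c ≠ 0 :=
    hc ▸ neg_ne_zero.2 (div_ne_zero (mul_ne_zero two_ne_zero hv) (by positivity))
  have hnorm : ‖s + c • v‖ = ‖s‖ := by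
    have hcv : c * ‖v‖ ^ 2 = -(2 * inner ℝ s v) := by
      rw [hc]
      field_simp
    rw [← sq_eq_sq₀ (norm_nonneg _) (norm_nonneg _), norm_add_sq_real, inner_smul_right,
      norm_smul, mul_pow, Real.norm_eq_abs, sq_abs]
    linear_combination c * hcv
  have hsecond := h.second_order_of_norm_eq hA hnorm
  rw [add_sub_cancel_left, map_smul, inner_smul_left, inner_smul_right, norm_smul, mul_pow,
    Real.norm_eq_abs, sq_abs, conj_trivial] at hsecond
  refine nonneg_of_mul_nonneg_right (a := c ^ 2) ?_ (by positivity)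
  linear_combination hsecond

theorem inner_apply_nonneg_of_zero (h : IsCubicStep M b A 0) (hA : A.IsSymmetric) (v : E) :
    0 ≤ inner ℝ v (A v) := by
  have hb : b = 0 := by simpa using h.first_order hA
  have hpos (t : ℝ) (ht : 0 < t) : 0 ≤ inner ℝ v (A v) + M / 3 * t * ‖v‖ ^ 3 := by
    have hmin := h (t • v)
    simp only [cubicForm, hb, inner_zero_left, norm_zero, map_smul, map_zero, inner_smul_left,
      inner_smul_right, norm_smul, Real.norm_of_nonneg ht.le, conj_trivial] at hmin
    refine nonneg_of_mul_nonneg_right (a := t ^ 2) ?_ (by positivity)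
    linear_combination 2 * hmin
  have hlim : Tendsto (fun t : ℝ => inner ℝ v (A v) + M / 3 * t * ‖v‖ ^ 3) (𝓝[>] 0)
      (𝓝 (inner ℝ v (A v))) :=
    ((Continuous.tendsto' (by fun_prop) 0 _ (by simp)).mono_left nhdsWithin_le_nhds)
  exact ge_of_tendsto hlim (by filter_upwards [self_mem_nhdsWithin] with t ht using hpos t ht)

theorem second_order (h : IsCubicStep M b A s) (hA : A.IsSymmetric) (v : E) :
    0 ≤ inner ℝ v (A v) + M / 2 * ‖s‖ * ‖v‖ ^ 2 := by
  rcases eq_or_ne s 0 with rfl | hs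
  · simpa using h.inner_apply_nonneg_of_zero hA v
  by_cases hv : inner ℝ s v = 0
  · have hlim : Tendsto (fun t : ℝ => inner ℝ (v + t • s) (A (v + t • s)) +
        M / 2 * ‖s‖ * ‖v + t • s‖ ^ 2) (𝓝[≠] 0)
        (𝓝 (inner ℝ v (A v) + M / 2 * ‖s‖ * ‖v‖ ^ 2)) :=
      (Continuous.tendsto' (by fun_prop) 0 _ (by simp)).mono_left nhdsWithin_le_nhds
    refine ge_of_tendsto hlim ?_
    filter_upwards [self_mem_nhdsWithin] with t ht
    refine h.second_order_of_inner_ne_zero hA ?_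
    rw [inner_add_right, hv, inner_smul_right, zero_add]
    exact mul_ne_zero ht (inner_self_ne_zero.2 hs)
  · exact h.second_order_of_inner_ne_zero hA hv

end IsCubicStep

end CubicStep

section LipschitzHessian

variable {E : Type*} [NormedAddCommGroup E] [InnerProductSpace ℝ E] [CompleteSpace E]
  {h : E → ℝ} {G : E → E} {H : E → E →L[ℝ] E} {L μ : ℝ}

/-- `h` is twice differentiable with gradient `G` and Hessian `H`, and `H` is `L`-Lipschitz. -/
structure HasLipschitzHessian (h : E → ℝ) (G : E → E) (H : E → E →L[ℝ] E) (L : ℝ) : Prop where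
  grad : ∀ y, HasGradientAt h (G y) y
  hess : ∀ y, HasFDerivAt G (H y) y
  lip : ∀ y y', ‖H y - H y'‖ ≤ L * ‖y - y'‖

namespace HasLipschitzHessian

variable (hh : HasLipschitzHessian h G H L)
include hh

theorem isSymmetric (y : E) : (H y).IsSymmetric := fun v w => by
  have hsymm := second_derivative_symmetric (fun z => (hh.grad z).hasFDerivAt)
    ((innerSL ℝ).hasFDerivAt.comp y (hh.hess y)) v w
  exact hsymm.trans (real_inner_comm v (H y w))

theorem inner_hess_ge (y y' v : E) :
    inner ℝ v (H y v) - L * ‖y - y'‖ * ‖v‖ ^ 2 ≤ inner ℝ v (H y' v) := by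
  have hdiff : inner ℝ v ((H y - H y') v) ≤ L * ‖y - y'‖ * ‖v‖ ^ 2 :=
    calc inner ℝ v ((H y - H y') v) ≤ ‖v‖ * ‖(H y - H y') v‖ := real_inner_le_norm _ _
      _ ≤ ‖v‖ * (‖H y - H y'‖ * ‖v‖) := by gcongr; exact ContinuousLinearMap.le_opNorm _ _
      _ ≤ ‖v‖ * (L * ‖y - y'‖ * ‖v‖) := by gcongr; exact hh.lip y y'
      _ = L * ‖y - y'‖ * ‖v‖ ^ 2 := by ring
  rw [sub_apply, inner_sub_right] at hdiff
  linarith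

theorem apply_add_le {y s : E} (hs : IsCubicStep L (G y) (H y) s) :
    h (y + s) ≤ h y - L / 12 * ‖s‖ ^ 3 := by
  have htaylor := (abs_le.1 (abs_sub_quadratic_le hh.grad hh.hess hh.lip y s)).2
  have hmodel := hs.cubicForm_le (hh.isSymmetric y)
  rw [cubicForm] at hmodel
  linarith

theorem norm_grad_add_le {y s : E} (hL : 0 ≤ L) (hs : IsCubicStep L (G y) (H y) s) :
    ‖G (y + s)‖ ≤ L * ‖s‖ ^ 2 := by
  have hfirst : G y + H y s = -((L / 2 * ‖s‖) • s) :=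
    eq_neg_of_add_eq_zero_left (hs.first_order (hh.isSymmetric y))
  calc ‖G (y + s)‖ = ‖(G (y + s) - G y - H y s) + (G y + H y s)‖ := by congr 1; abel
    _ ≤ ‖G (y + s) - G y - H y s‖ + ‖G y + H y s‖ := norm_add_le _ _
    _ ≤ L / 2 * ‖s‖ ^ 2 + L / 2 * ‖s‖ * ‖s‖ := by
        rw [hfirst, norm_neg, norm_smul, Real.norm_of_nonneg (by positivity)]
        gcongr
        exact norm_sub_linear_le hh.hess hh.lip y s
    _ = L * ‖s‖ ^ 2 := by ring

theorem inner_hess_add_ge {y s : E} (hs : IsCubicStep L (G y) (H y) s) (v : E) :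
    -(3 * L / 2 * ‖s‖ * ‖v‖ ^ 2) ≤ inner ℝ v (H (y + s) v) := by
  have hsecond := hs.second_order (hh.isSymmetric y) v
  have hlip := hh.inner_hess_ge y (y + s) v
  rw [sub_add_cancel_left, norm_neg] at hlip
  linarith

theorem sum_norm_step_pow_le {y : ℕ → E}
    (hy : ∀ k, IsCubicStep L (G (y k)) (H (y k)) (y (k + 1) - y k)) (K : ℕ) :
    ∑ k ∈ Finset.range K, L / 12 * ‖y (k + 1) - y k‖ ^ 3 ≤ h (y 0) - h (y K) := by
  induction K with
  | zero => simp
  | succ K ih =>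
    have hstep := hh.apply_add_le (hy K)
    rw [add_sub_cancel] at hstep
    rw [Finset.sum_range_succ]
    linarith

section NearMinimizer

variable {p : E} (hL : 0 < L) (hpos : ∀ v, μ * ‖v‖ ^ 2 ≤ inner ℝ v (H p v))
include hL hpos

theorem norm_sub_le_norm_grad {y : E} (hp : G p = 0) (hy : ‖y - p‖ ≤ μ / (2 * L)) :
    3 / 4 * μ * ‖y - p‖ ≤ ‖G y‖ := by
  rcases (norm_nonneg (y - p)).eq_or_lt with hzero | hne
  · simp [← hzero]
  have htaylor := norm_sub_linear_le hh.hess hh.lip p (y - p)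
  rw [add_sub_cancel, hp, sub_zero] at htaylor
  have hupper : inner ℝ (y - p) (H p (y - p)) ≤
      ‖y - p‖ * ‖G y‖ + ‖y - p‖ * (L / 2 * ‖y - p‖ ^ 2) := by
    calc inner ℝ (y - p) (H p (y - p))
        = inner ℝ (y - p) (G y) - inner ℝ (y - p) (G y - H p (y - p)) := by
          rw [← inner_sub_right, sub_sub_cancel]
      _ ≤ ‖y - p‖ * ‖G y‖ + ‖y - p‖ * ‖G y - H p (y - p)‖ := by
          rw [sub_eq_add_neg, ← inner_neg_right, ← norm_neg (G y - H p (y - p))]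
          exact add_le_add (real_inner_le_norm _ _) (real_inner_le_norm _ _)
      _ ≤ _ := by gcongr
  rw [le_div_iff₀ (by positivity)] at hy
  refine le_of_mul_le_mul_left ?_ hne
  nlinarith [hpos (y - p), sq_nonneg ‖y - p‖]

theorem norm_step_le_norm_grad {y s : E} (hy : ‖y - p‖ ≤ μ / (2 * L))
    (hs : IsCubicStep L (G y) (H y) s) : μ / 2 * ‖s‖ ≤ ‖G y‖ := by
  rcases (norm_nonneg s).eq_or_lt with hzero | hne
  · simp [← hzero]
  have hhess : μ / 2 * ‖s‖ ^ 2 ≤ inner ℝ s (H y s) := by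
    have hlip := hh.inner_hess_ge p y s
    rw [norm_sub_rev, le_div_iff₀ (by positivity)] at hy
    nlinarith [hpos s, sq_nonneg ‖s‖]
  have hfirst := hs.inner_first_order (hh.isSymmetric y)
  have hcauchy := neg_le_of_abs_le (abs_real_inner_le_norm (G y) s)
  have hcubic : 0 ≤ L / 2 * ‖s‖ ^ 3 := by positivity
  refine le_of_mul_le_mul_left ?_ hne
  nlinarith

theorem contraction_step (hμ : 0 < μ) {y s : E} (hp : G p = 0) (hy : ‖y - p‖ ≤ μ / (2 * L))
    (hGy : ‖G y‖ ≤ 9 / 64 * (μ ^ 2 / L)) (hs : IsCubicStep L (G y) (H y) s) :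
    ‖y + s - p‖ ≤ μ / (2 * L) ∧ ‖G (y + s)‖ ≤ 9 / 16 * ‖G y‖ := by
  have hdist := hh.norm_sub_le_norm_grad hL hpos hp hy
  have hstep := hh.norm_step_le_norm_grad hL hpos hy hs
  have hGy' : ‖G y‖ ≤ μ * (9 / 64 * (μ / L)) := hGy.trans_eq (by ring)
  have hs_le : ‖s‖ ≤ 9 / 32 * (μ / L) :=
    le_of_mul_le_mul_left (a := μ / 2) (by linarith) (half_pos hμ)
  have hy_le : ‖y - p‖ ≤ 3 / 16 * (μ / L) :=
    le_of_mul_le_mul_left (a := 3 / 4 * μ) (by linarith) (by positivity)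
  constructor
  · calc ‖y + s - p‖ = ‖(y - p) + s‖ := by congr 1; abel
      _ ≤ ‖y - p‖ + ‖s‖ := norm_add_le _ _
      _ ≤ 3 / 16 * (μ / L) + 9 / 32 * (μ / L) := add_le_add hy_le hs_le
      _ ≤ 1 / 2 * (μ / L) := by linarith [div_pos hμ hL]
      _ = μ / (2 * L) := by field_simp
  · calc ‖G (y + s)‖ ≤ L * ‖s‖ ^ 2 := hh.norm_grad_add_le hL.le hs
      _ = L * (‖s‖ * ‖s‖) := by ring
      _ ≤ L * (9 / 32 * (μ / L) * ‖s‖) := by gcongr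
      _ = 9 / 16 * (μ / 2 * ‖s‖) := by field_simp; ring
      _ ≤ 9 / 16 * ‖G y‖ := by gcongr

theorem tendsto_of_near (hμ : 0 < μ) (hp : G p = 0) {y : ℕ → E}
    (hstep : ∀ k, IsCubicStep L (G (y k)) (H (y k)) (y (k + 1) - y k)) {k : ℕ}
    (hy : ‖y k - p‖ ≤ μ / (2 * L)) (hGy : ‖G (y k)‖ ≤ 9 / 64 * (μ ^ 2 / L)) :
    Tendsto y atTop (𝓝 p) := by
  have hnear (j : ℕ) : ‖y (j + k) - p‖ ≤ μ / (2 * L) ∧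
      ‖G (y (j + k))‖ ≤ (9 / 16) ^ j * (9 / 64 * (μ ^ 2 / L)) := by
    induction j with
    | zero => simpa using ⟨hy, hGy⟩
    | succ j ih =>
      have hGj : ‖G (y (j + k))‖ ≤ 9 / 64 * (μ ^ 2 / L) :=
        ih.2.trans (mul_le_of_le_one_left (by positivity)
          (pow_le_one₀ (by norm_num) (by norm_num)))
      have hnext := hh.contraction_step hL hpos hμ hp ih.1 hGj (hstep (j + k))
      rw [add_sub_cancel, ← Nat.add_right_comm] at hnext
      refine ⟨hnext.1, hnext.2.trans ?_⟩
      rw [pow_succ']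
      linarith [ih.2]
  rw [← tendsto_add_atTop_iff_nat k, tendsto_iff_norm_sub_tendsto_zero]
  have hgeom : Tendsto (fun j : ℕ => (9 / 16 : ℝ) ^ j * (9 / 64 * (μ ^ 2 / L)) / (3 / 4 * μ)) atTop
      (𝓝 0) := by
    simpa using ((tendsto_pow_atTop_nhds_zero_of_lt_one (by norm_num : (0 : ℝ) ≤ 9 / 16)
      (by norm_num)).mul_const (9 / 64 * (μ ^ 2 / L))).div_const (3 / 4 * μ)
  refine squeeze_zero (fun _ => norm_nonneg _) (fun j => ?_) hgeom
  rw [le_div_iff₀' (by positivity)]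
  exact (hh.norm_sub_le_norm_grad hL hpos hp (hnear j).1).trans (hnear j).2

end NearMinimizer

end HasLipschitzHessian

end LipschitzHessian

section Persistence

variable {E F : Type*} [NormedAddCommGroup E] [NormedSpace ℝ E] [NormedAddCommGroup F]
  [NormedSpace ℝ F]

theorem exists_pos_forall_of_eventually {Z : Type*} [TopologicalSpace Z] {K : Set Z}
    (hK : IsCompact K) {P : ℝ → Z → Prop} (hP : ∀ z, Antitone fun c => P c z)
    (hloc : ∀ z ∈ K, ∃ c > 0, ∀ᶠ w in 𝓝[K] z, P c w) : ∃ c > 0, ∀ z ∈ K, P c z := by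
  refine hK.induction_on (p := fun s => ∃ c > 0, ∀ z ∈ s, P c z) ⟨1, one_pos, by simp⟩ ?_ ?_ ?_
  · rintro s t hst ⟨c, hc, ht⟩
    exact ⟨c, hc, fun z hz => ht z (hst hz)⟩
  · rintro s t ⟨c, hc, hs⟩ ⟨c', hc', ht⟩
    exact ⟨min c c', lt_min hc hc', fun z hz => hz.elim
      (fun hzs => hP z (min_le_left c c') (hs z hzs))
      fun hzt => hP z (min_le_right c c') (ht z hzt)⟩
  · intro z hz
    obtain ⟨c, hc, hev⟩ := hloc z hz
    exact ⟨_, hev, c, hc, fun w hw => hw⟩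

theorem exists_mul_norm_le_of_det_ne_zero [FiniteDimensional ℝ E] {T : E →L[ℝ] E}
    (hT : T.det ≠ 0) : ∃ c > 0, ∀ v, c * ‖v‖ ≤ ‖T v‖ :=
  antilipschitzWith_iff_exists_mul_le_norm.1
    ⟨_, (T.toContinuousLinearEquivOfDetNeZero hT).antilipschitz⟩

/-- A quantitative inverse function theorem in `y` replaces the implicit function theorem, which is
not available at a boundary point `x₀` of `X`. -/
theorem eventually_exists_mem_closedBall_eq_zero [CompleteSpace E] {P : Type*} [TopologicalSpace P]
    {φ : P → E → F} {φ' : P → E → E →L[ℝ] F} {X : Set P} {x₀ : P} {y₀ : E} {e : E ≃L[ℝ] F}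
    (hφ : ∀ x ∈ X, ∀ y, HasFDerivAt (φ x) (φ' x y) y)
    (hφ' : Tendsto (fun p : P × E => φ' p.1 p.2) (𝓝[X ×ˢ univ] (x₀, y₀)) (𝓝 e))
    (hφ₀ : Tendsto (φ · y₀) (𝓝[X] x₀) (𝓝 0)) {ε : ℝ} (hε : 0 < ε) :
    ∀ᶠ x in 𝓝[X] x₀, ∃ w ∈ Metric.closedBall y₀ ε, φ x w = 0 := by
  rcases e.subsingleton_or_nnnorm_symm_pos with hE | hN
  · have : Subsingleton F := e.symm.toEquiv.subsingleton
    exact Eventually.of_forall fun x =>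
      ⟨y₀, Metric.mem_closedBall_self hε.le, Subsingleton.elim _ _⟩
  set c : ℝ≥0 := ‖(e.symm : F →L[ℝ] E)‖₊⁻¹ / 2 with hc_def
  have hc : 0 < c := half_pos (inv_pos.2 hN)
  rw [nhdsWithin_prod_eq, nhdsWithin_univ] at hφ'
  obtain ⟨A, hA, B, hB, hAB⟩ := eventually_prod_iff.1
    (hφ' (Metric.closedBall_mem_nhds (e : E →L[ℝ] F) (NNReal.coe_pos.2 hc)))
  obtain ⟨r, hr, hrB⟩ := Metric.nhds_basis_closedBall.mem_iff.1 hB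
  filter_upwards [hA, self_mem_nhdsWithin,
    hφ₀ (Metric.closedBall_mem_nhds 0 (mul_pos (NNReal.coe_pos.2 hc) (lt_min hε hr)))]
    with x hxA hxX hx₀
  have happrox : ApproximatesLinearOn (φ x) (e : E →L[ℝ] F) (Metric.closedBall y₀ (min ε r)) c :=
    fun a ha b hb => (convex_closedBall _ _).norm_image_sub_le_of_norm_hasFDerivWithin_le'
      (fun w _ => (hφ x hxX w).hasFDerivWithinAt)
      (fun w hw => mem_closedBall_iff_norm.1
        (hAB hxA (hrB (Metric.closedBall_subset_closedBall (min_le_right ε r) hw)))) hb ha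
  have hsurj := happrox.surjOn_closedBall_of_nonlinearRightInverse e.toNonlinearRightInverse
    (lt_min hε hr).le Subset.rfl
  have hconst : ((e.toNonlinearRightInverse.nnnorm : ℝ)⁻¹ - c) * min ε r = c * min ε r := by
    change ((‖(e.symm : F →L[ℝ] E)‖₊ : ℝ)⁻¹ - c) * _ = _
    rw [hc_def]
    push_cast
    ring
  rw [hconst] at hsurj
  obtain ⟨w, hw, hw₀⟩ := hsurj (Metric.mem_closedBall_comm.1 hx₀)
  exact ⟨w, Metric.closedBall_subset_closedBall (min_le_left ε r) hw, hw₀⟩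

end Persistence

section ExistenceOfBounds

variable {n m : ℕ} {g : Vec n → Vec m → ℝ} {X F : Set (Vec n)} {Y Y' : Set (Vec m)} {L δ : ℝ}

/-- The regularity of the lower-level objective on which the argument rests: `g(x, ·)` has an
`L`-Lipschitz Hessian for each `x ∈ X`, and `∇_y g`, `∇²_yy g` are jointly continuous. -/
structure HasRegularFibers (g : Vec n → Vec m → ℝ) (X : Set (Vec n)) (L : ℝ) : Prop where
  hasLipschitzHessian : ∀ x ∈ X, HasLipschitzHessian (g x) (gradY g x) (hessY g x) L
  continuousOn_gradY : ContinuousOn (fun p : Vec n × Vec m => gradY g p.1 p.2) (X ×ˢ univ)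
  continuousOn_hessY : ContinuousOn (fun p : Vec n × Vec m => hessY g p.1 p.2) (X ×ˢ univ)

theorem isMorseAt_of_notMem_thickening (hδ : 0 < δ) {x : Vec n}
    (hx : x ∈ X \ Metric.thickening δ (bifurcationSet g X)) : IsMorseAt g x := by
  by_contra hMorse
  exact hx.2 (Metric.self_subset_thickening hδ _ ⟨hx.1, hMorse⟩)

theorem diff_bifurcationNhd_subset :
    X \ bifurcationNhd g X δ ⊆ X \ Metric.thickening δ (bifurcationSet g X) :=
  fun _ hx => ⟨hx.1, fun hδ => hx.2 ⟨hx.1, Metric.thickening_subset_cthickening _ _ hδ⟩⟩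

namespace HasRegularFibers

variable (hg : HasRegularFibers g X L)
include hg

theorem exists_mul_norm_le_hessY (hF : IsCompact F) (hFX : F ⊆ X)
    (hMorse : ∀ x ∈ F, IsMorseAt g x) (hY' : IsCompact Y') :
    ∃ c > 0, ∀ p ∈ F ×ˢ Y', gradY g p.1 p.2 = 0 → ∀ v, c * ‖v‖ ≤ ‖hessY g p.1 p.2 v‖ := by
  have hsub : F ×ˢ Y' ⊆ X ×ˢ univ := prod_mono hFX (subset_univ _)
  refine exists_pos_forall_of_eventually (hF.prod hY')
    (fun p c c' hcc' hc' hp v => (mul_le_mul_of_nonneg_right hcc' (norm_nonneg v)).trans (hc' hp v))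
    fun p hp => ?_
  by_cases hgrad : gradY g p.1 p.2 = 0
  · obtain ⟨c, hc, hcv⟩ := exists_mul_norm_le_of_det_ne_zero (hMorse _ hp.1 _ hgrad)
    refine ⟨c / 2, half_pos hc, ?_⟩
    filter_upwards [((hg.continuousOn_hessY.mono hsub) p hp) (Metric.ball_mem_nhds _ (half_pos hc))]
      with q hq _ v
    have hdiff : ‖hessY g q.1 q.2 v - hessY g p.1 p.2 v‖ ≤ c / 2 * ‖v‖ :=
      (hessY g q.1 q.2 - hessY g p.1 p.2).le_of_opNorm_le (mem_ball_iff_norm.1 hq).le v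
    linarith [hcv v, norm_le_norm_add_norm_sub (hessY g q.1 q.2 v) (hessY g p.1 p.2 v)]
  · exact ⟨1, one_pos, (((hg.continuousOn_gradY.mono hsub) p hp).eventually_ne hgrad).mono
      fun q hq hq₀ => absurd hq₀ hq⟩

theorem exists_isEigenvalueBound (hX : IsCompact X) (hY' : IsCompact Y') :
    ∃ μ : ℝ → ℝ, IsEigenvalueBound g X Y' μ := by
  have hbound : ∀ δ > 0, ∃ c, 0 < c ∧ ∀ x ∈ X \ bifurcationNhd g X δ, ∀ y ∈ Y',
      gradY g x y = 0 → ∀ v, c * ‖v‖ ≤ ‖hessY g x y v‖ := by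
    intro δ hδ
    obtain ⟨c, hc, hcv⟩ := hg.exists_mul_norm_le_hessY (hX.diff Metric.isOpen_thickening)
      sdiff_subset (fun x hx => isMorseAt_of_notMem_thickening hδ hx) hY'
    exact ⟨c, hc, fun x hx y hy => hcv (x, y) ⟨diff_bifurcationNhd_subset hx, hy⟩⟩
  choose! μ hμ using hbound
  refine ⟨μ, fun δ hδ => ⟨(hμ δ hδ).1, fun x hx y hy hgrad l hl => ?_⟩⟩
  obtain ⟨v, hv⟩ := hl.exists_hasEigenvector
  have hle := (hμ δ hδ).2 x hx y hy hgrad v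
  have happly : hessY g x y v = l • v := hv.apply_eq_smul
  rw [happly, norm_smul, Real.norm_eq_abs] at hle
  exact le_of_mul_le_mul_right hle (norm_pos_iff.2 hv.2)

theorem eventually_mem_cthickening_critSet {r : ℝ} (hr : 0 < r) {x : Vec n} {y : Vec m}
    (hx : x ∈ X) (hy : Y' ∈ 𝓝 y) (hgrad : gradY g x y = 0) (hdet : (hessY g x y).det ≠ 0) :
    ∀ᶠ q in 𝓝[X ×ˢ univ] (x, y), q.2 ∈ Metric.cthickening r (critSet g Y' q.1) := by
  obtain ⟨ε, hε, hball⟩ := Metric.nhds_basis_closedBall.mem_iff.1 hy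
  have hmem : (x, y) ∈ X ×ˢ (univ : Set (Vec m)) := ⟨hx, mem_univ y⟩
  have hhess : Tendsto (fun p : Vec n × Vec m => hessY g p.1 p.2) (𝓝[X ×ˢ univ] (x, y))
      (𝓝 ((hessY g x y).toContinuousLinearEquivOfDetNeZero hdet : Vec m →L[ℝ] Vec m)) := by
    simpa using (hg.continuousOn_hessY (x, y) hmem).tendsto
  have hgrad₀ : Tendsto (gradY g · y) (𝓝[X] x) (𝓝 0) := by
    have hslice : ContinuousOn (gradY g · y) X :=
      hg.continuousOn_gradY.comp (f := fun x' => (x', y)) (by fun_prop)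
        fun x' hx' => ⟨hx', mem_univ y⟩
    simpa [hgrad] using (hslice x hx).tendsto
  have hzero := eventually_exists_mem_closedBall_eq_zero
    (fun x hx => (hg.hasLipschitzHessian x hx).hess) hhess hgrad₀ (lt_min hε (half_pos hr))
  rw [nhdsWithin_prod_eq, nhdsWithin_univ]
  filter_upwards [hzero.prod_mk (Metric.closedBall_mem_nhds y (half_pos hr))]
  rintro q ⟨⟨w, hw, hw₀⟩, hq⟩
  refine Metric.mem_cthickening_of_dist_le q.2 w r _
    ⟨hball (Metric.closedBall_subset_closedBall (min_le_left _ _) hw), hw₀⟩ ?_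
  have hwy : dist w y ≤ r / 2 := (Metric.mem_closedBall.1 hw).trans (min_le_right _ _)
  linarith [dist_triangle_right q.2 w y, Metric.mem_closedBall.1 hq]

theorem exists_le_norm_gradY (hF : IsCompact F) (hFX : F ⊆ X) (hMorse : ∀ x ∈ F, IsMorseAt g x)
    (hY : IsCompact Y) (hYY' : Y ⊆ interior Y') {r : ℝ} (hr : 0 < r) :
    ∃ c > 0, ∀ p ∈ F ×ˢ Y, p.2 ∉ Metric.cthickening r (critSet g Y' p.1) →
      c ≤ ‖gradY g p.1 p.2‖ := by
  have hsub : F ×ˢ Y ⊆ X ×ˢ univ := prod_mono hFX (subset_univ _)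
  refine exists_pos_forall_of_eventually (hF.prod hY)
    (fun p c c' hcc' hc' hp => hcc'.trans (hc' hp)) ?_
  rintro ⟨x, y⟩ ⟨hx, hy⟩
  by_cases hgrad : gradY g x y = 0
  · have hnear := hg.eventually_mem_cthickening_critSet hr (hFX hx)
      (mem_interior_iff_mem_nhds.1 (hYY' hy)) hgrad (hMorse x hx y hgrad)
    exact ⟨1, one_pos, (hnear.filter_mono (nhdsWithin_mono _ hsub)).mono
      fun q hq hq' => absurd hq hq'⟩
  · have hpos : 0 < ‖gradY g x y‖ := norm_pos_iff.2 hgrad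
    have hcont := ((hg.continuousOn_gradY.mono hsub) (x, y) ⟨hx, hy⟩).norm
    exact ⟨_, half_pos hpos, (hcont.eventually_const_lt (half_lt_self hpos)).mono
      fun q hq _ => le_of_lt hq⟩

theorem exists_isGradientBound (hX : IsCompact X) (hY : IsCompact Y) (hYY' : Y ⊆ interior Y') :
    ∃ α : ℝ → ℝ → ℝ, IsGradientBound g X Y Y' α := by
  have hbound : ∀ δ > 0, ∀ r > 0, ∃ c, 0 < c ∧ ∀ x ∈ X \ bifurcationNhd g X δ,
      ∀ y ∈ Y \ Metric.cthickening r (critSet g Y' x), c ≤ ‖gradY g x y‖ := by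
    intro δ hδ r hr
    obtain ⟨c, hc, hcg⟩ := hg.exists_le_norm_gradY (hX.diff Metric.isOpen_thickening)
      sdiff_subset (fun x hx => isMorseAt_of_notMem_thickening hδ hx) hY hYY' hr
    exact ⟨c, hc, fun x hx y hy => hcg (x, y) ⟨diff_bifurcationNhd_subset hx, hy.1⟩ hy.2⟩
  choose! α hα using hbound
  exact ⟨α, hα⟩

end HasRegularFibers

end ExistenceOfBounds

section SmallestEigenvalue

theorem mul_norm_sq_le_inner_of_le_abs_eigenvalue {E : Type*} [NormedAddCommGroup E]
    [InnerProductSpace ℝ E] [FiniteDimensional ℝ E] {T : E →ₗ[ℝ] E} (hT : T.IsSymmetric)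
    {μ c : ℝ} (hc : c < μ) (heig : ∀ l, Module.End.HasEigenvalue T l → μ ≤ |l|)
    (hlow : ∀ v, -(c * ‖v‖ ^ 2) ≤ inner ℝ v (T v)) (v : E) :
    μ * ‖v‖ ^ 2 ≤ inner ℝ v (T v) := by
  set b := hT.eigenvectorBasis rfl
  set l := hT.eigenvalues rfl
  have hTb (i) : T (b i) = l i • b i := hT.apply_eigenvectorBasis rfl i
  have hl (i) : μ ≤ l i := by
    have hneg : -c ≤ l i := by
      have hlow_b := hlow (b i)
      rw [hTb, inner_smul_right, real_inner_self_eq_norm_sq, b.norm_eq_one] at hlow_b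
      linarith
    have habs : μ ≤ |l i| := heig _ (hT.hasEigenvalue_eigenvalues rfl i)
    rcases le_abs.1 habs with h | h
    · exact h
    · linarith
  calc μ * ‖v‖ ^ 2 = ∑ i, μ * (inner ℝ v (b i) * inner ℝ (b i) v) := by
        rw [← Finset.mul_sum, b.sum_inner_mul_inner, real_inner_self_eq_norm_sq]
    _ ≤ ∑ i, l i * (inner ℝ v (b i) * inner ℝ (b i) v) := by
        refine Finset.sum_le_sum fun i _ => mul_le_mul_of_nonneg_right (hl i) ?_
        rw [real_inner_comm]
        exact mul_self_nonneg _
    _ = ∑ i, inner ℝ v (b i) * inner ℝ (b i) (T v) := by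
        refine Finset.sum_congr rfl fun i _ => ?_
        rw [← hT, hTb, inner_smul_left, conj_trivial]
        ring
    _ = inner ℝ v (T v) := b.sum_inner_mul_inner v (T v)

variable {m : ℕ} {T : Vec m →L[ℝ] Vec m}

theorem neg_norm_le_inner_of_mem_sphere (T : Vec m →L[ℝ] Vec m) (v : Metric.sphere (0 : Vec m) 1) :
    -‖T‖ ≤ inner ℝ (T v) (v : Vec m) := by
  have hv : ‖(v : Vec m)‖ = 1 := mem_sphere_zero_iff_norm.1 v.2
  have hcauchy := neg_le_of_abs_le (abs_real_inner_le_norm (T v) v)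
  rw [hv, mul_one] at hcauchy
  exact (neg_le_neg (T.unit_le_opNorm v hv.le)).trans hcauchy

theorem lambdaMin_mul_norm_sq_le (T : Vec m →L[ℝ] Vec m) (v : Vec m) :
    lambdaMin T * ‖v‖ ^ 2 ≤ inner ℝ v (T v) := by
  rcases eq_or_ne v 0 with rfl | hv
  · simp
  have hv₀ : 0 < ‖v‖ := norm_pos_iff.2 hv
  have hle := ciInf_le ⟨-‖T‖, forall_mem_range.2 (neg_norm_le_inner_of_mem_sphere T)⟩
    ⟨‖v‖⁻¹ • v, by simp [norm_smul, hv₀.ne']⟩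
  simp only [map_smul, inner_smul_left, inner_smul_right, conj_trivial] at hle
  rw [real_inner_comm]
  calc lambdaMin T * ‖v‖ ^ 2 ≤ ‖v‖⁻¹ * (‖v‖⁻¹ * inner ℝ (T v) v) * ‖v‖ ^ 2 := by gcongr; exact hle
    _ = inner ℝ (T v) v := by field_simp

theorem neg_le_lambdaMin {c : ℝ} (hc : 0 ≤ c) (h : ∀ v, -(c * ‖v‖ ^ 2) ≤ inner ℝ v (T v)) :
    -c ≤ lambdaMin T := by
  -- For `m = 0` the sphere is empty and `lambdaMin T` is the junk value `0`.
  rcases isEmpty_or_nonempty (Metric.sphere (0 : Vec m) 1) with _ | _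
  · rw [lambdaMin, Real.iInf_of_isEmpty]
    linarith
  · refine le_ciInf fun v => ?_
    rw [real_inner_comm]
    simpa [mem_sphere_zero_iff_norm.1 v.2] using h v

end SmallestEigenvalue

section IterationBound

variable {Δ L η K : ℝ}

theorem mul_sq_le_of_iteration_bound {a : ℝ} (hL : 0 < L) (ha : 0 < a) (hK : 0 < K)
    (hsum : L / 12 * K * η ^ 3 ≤ Δ)
    (hiter : 256 * Δ * L ^ ((1 : ℝ) / 2) / (9 * a ^ ((3 : ℝ) / 2)) < K) (hη : 0 ≤ η) :
    L * η ^ 2 ≤ 9 / 16 * a := by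
  have hrpow : a ^ ((3 : ℝ) / 2) = √a ^ 3 := by
    rw [Real.rpow_div_two_eq_sqrt 3 ha.le, ← Real.rpow_natCast]
    norm_num
  have ha' : 0 < √a := Real.sqrt_pos.2 ha
  rw [hrpow, ← Real.sqrt_eq_rpow, div_lt_iff₀ (by positivity)] at hiter
  have hcube : K * (√L * η) ^ 3 ≤ K * (3 / 4 * √a) ^ 3 := by
    have hscaled := mul_le_mul_of_nonneg_left hsum (Real.sqrt_nonneg L)
    calc K * (√L * η) ^ 3 = √L * (√L ^ 2 * K * η ^ 3) := by ring
      _ = 12 * (√L * (L / 12 * K * η ^ 3)) := by rw [Real.sq_sqrt hL.le]; ring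
      _ ≤ 12 * (√L * Δ) := by gcongr
      _ ≤ K * (3 / 4 * √a) ^ 3 := by linarith
  have hroot : √L * η ≤ 3 / 4 * √a :=
    le_of_pow_le_pow_left₀ three_ne_zero (by positivity) (le_of_mul_le_mul_left hcube hK)
  calc L * η ^ 2 = (√L * η) ^ 2 := by rw [mul_pow, Real.sq_sqrt hL.le]
    _ ≤ (3 / 4 * √a) ^ 2 := by gcongr
    _ = 9 / 16 * a := by rw [mul_pow, Real.sq_sqrt ha.le]; norm_num

theorem four_mul_le_of_iteration_bound {μ : ℝ} (hμ : 0 < μ) (hK : 0 < K)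
    (hsum : L / 12 * K * η ^ 3 ≤ Δ) (hiter : 768 * Δ * L ^ 2 / μ ^ 3 < K) : 4 * L * η ≤ μ := by
  rw [div_lt_iff₀ (by positivity)] at hiter
  have hcube : K * (4 * L * η) ^ 3 ≤ K * μ ^ 3 := by
    have hscaled := mul_le_mul_of_nonneg_left hsum (sq_nonneg L)
    linarith
  exact le_of_pow_le_pow_left₀ three_ne_zero hμ.le (le_of_mul_le_mul_left hcube hK)

theorem bounds_of_iterBound_lt {gBar gLow a μ ρ : ℝ} (hL : 0 < L) (ha : 0 < a) (hμ : 0 < μ)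
    (hρ : 0 < ρ) (hη : 0 ≤ η) (hK₀ : 0 ≤ K) (hsum : L / 12 * K * η ^ 3 ≤ gBar - gLow)
    (hK : iterBound₁ gBar gLow L μ a + iterBound₂ gBar gLow L μ ρ < K) :
    L * η ^ 2 ≤ 9 / 16 * min a (μ ^ 2 / (4 * L)) ∧ 4 * L * η ≤ μ ∧
      L * η ^ 2 ≤ 9 / 16 * (μ * ρ / 2) := by
  have hΔ : 0 ≤ gBar - gLow := le_trans (by positivity) hsum
  have hmin : 0 < min a (μ ^ 2 / (4 * L)) := lt_min ha (by positivity)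
  have hbound₂ : 0 ≤ iterBound₂ gBar gLow L μ ρ := by unfold iterBound₂; positivity
  have hbound₁ : 0 ≤ iterBound₁ gBar gLow L μ a := le_max_of_le_right (by positivity)
  have hKpos : 0 < K := by linarith
  have hK₁ : iterBound₁ gBar gLow L μ a < K := by linarith
  have hK₂ : iterBound₂ gBar gLow L μ ρ < K := by linarith
  exact ⟨mul_sq_le_of_iteration_bound hL hmin hKpos hsum ((le_max_left _ _).trans_lt hK₁) hη,
    four_mul_le_of_iteration_bound hμ hKpos hsum ((le_max_right _ _).trans_lt hK₁),
    mul_sq_le_of_iteration_bound hL (by positivity) hKpos hsum hK₂ hη⟩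

end IterationBound

section Output

variable {n m : ℕ} {g : Vec n → Vec m → ℝ} {x : Vec n} {Y Y' : Set (Vec m)} {y₀ : Vec m}
  {gLow gBar L M μ a ρ : ℝ}

theorem stationarity_nonneg (M : ℝ) (g : Vec n → Vec m → ℝ) (x : Vec n) (y : Vec m) :
    0 ≤ stationarity M g x y :=
  le_max_of_le_left (Real.sqrt_nonneg _)

theorem norm_gradY_le_stationarity (hM : 0 < M) (y : Vec m) :
    ‖gradY g x y‖ ≤ M * stationarity M g x y ^ 2 := by
  have hsqrt : √(1 / M * ‖gradY g x y‖) ≤ stationarity M g x y := le_max_left _ _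
  rwa [Real.sqrt_le_left (stationarity_nonneg M g x y), one_div, inv_mul_le_iff₀ hM] at hsqrt

theorem inner_hessY_ge_stationarity (hM : 0 < M) (y v : Vec m) :
    -(3 * M / 2 * stationarity M g x y * ‖v‖ ^ 2) ≤ inner ℝ v (hessY g x y v) := by
  have hmax : -(2 / (3 * M)) * lambdaMin (hessY g x y) ≤ stationarity M g x y := le_max_right _ _
  have hlambda : -(3 * M / 2 * stationarity M g x y) ≤ lambdaMin (hessY g x y) := by
    rw [neg_mul, neg_le, div_mul_eq_mul_div, le_div_iff₀ (by positivity)] at hmax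
    linarith
  linarith [mul_le_mul_of_nonneg_right hlambda (sq_nonneg ‖v‖),
    lambdaMin_mul_norm_sq_le (hessY g x y) v]

theorem stationarity_le {y : Vec m} {η : ℝ} (hM : 0 < M) (hη : 0 ≤ η)
    (hgrad : ‖gradY g x y‖ ≤ M * η ^ 2)
    (hhess : ∀ v, -(3 * M / 2 * η * ‖v‖ ^ 2) ≤ inner ℝ v (hessY g x y v)) :
    stationarity M g x y ≤ η := by
  refine max_le ?_ ?_
  · rwa [Real.sqrt_le_left hη, one_div, inv_mul_le_iff₀ hM]
  · have hlambda := neg_le_lambdaMin (by positivity) hhess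
    rw [neg_mul, neg_le, div_mul_eq_mul_div, le_div_iff₀ (by positivity)]
    linarith

theorem exists_mem_critSet_norm_sub_le {r : ℝ} (hcont : Continuous (gradY g x))
    (hY' : IsCompact Y') (hr : 0 ≤ r)
    (hgrad : ∀ y ∈ Y \ Metric.cthickening r (critSet g Y' x), a ≤ ‖gradY g x y‖)
    {y : Vec m} (hy : y ∈ Y) (hlt : ‖gradY g x y‖ < a) : ∃ q ∈ critSet g Y' x, ‖y - q‖ ≤ r := by
  have hcrit : IsCompact (critSet g Y' x) := hY'.inter_right (isClosed_eq hcont continuous_const)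
  have hclose : y ∈ Metric.cthickening r (critSet g Y' x) := by
    by_contra hfar
    exact (hgrad y ⟨hy, hfar⟩).not_gt hlt
  rw [hcrit.cthickening_eq_biUnion_closedBall hr] at hclose
  simpa [dist_eq_norm] using hclose

theorem HasLipschitzHessian.mul_norm_sq_le_inner_near
    (hh : HasLipschitzHessian (g x) (gradY g x) (hessY g x) L) (hL : 0 < L) (hμ : 0 < μ)
    {q y : Vec m}
    (heig : ∀ l, Module.End.HasEigenvalue (hessY g x q : Vec m →ₗ[ℝ] Vec m) l → μ ≤ |l|)
    (hdist : ‖y - q‖ ≤ μ / (2 * L)) (hstat : 4 * L * stationarity L g x y ≤ μ) (v : Vec m) :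
    μ * ‖v‖ ^ 2 ≤ inner ℝ v (hessY g x q v) := by
  refine mul_norm_sq_le_inner_of_le_abs_eigenvalue (hh.isSymmetric q) (c := 7 / 8 * μ)
    (by linarith) heig (fun v => ?_) v
  rw [le_div_iff₀ (by positivity)] at hdist
  have hdrift : L * ‖y - q‖ * ‖v‖ ^ 2 ≤ μ / 2 * ‖v‖ ^ 2 := by gcongr; linarith
  have hstat_v := mul_le_mul_of_nonneg_right hstat (sq_nonneg ‖v‖)
  have hlip := hh.inner_hess_ge y q v
  have hcurv := inner_hessY_ge_stationarity (g := g) (x := x) hL y v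
  rw [ContinuousLinearMap.coe_coe]
  linarith

namespace IsCubicNewtonRun

variable {y : ℕ → Vec m} (hrun : IsCubicNewtonRun L g y₀ x y)
  (hh : HasLipschitzHessian (g x) (gradY g x) (hessY g x) L) (hL : 0 < L)
include hrun

theorem isCubicStep (k : ℕ) :
    IsCubicStep L (gradY g x (y k)) (hessY g x (y k)) (y (k + 1) - y k) :=
  hrun.2 k

include hh hL

theorem stationarity_succ_le (k : ℕ) : stationarity L g x (y (k + 1)) ≤ ‖y (k + 1) - y k‖ := by
  have hgrad := hh.norm_grad_add_le hL.le (hrun.isCubicStep k)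
  have hhess := hh.inner_hess_add_ge (hrun.isCubicStep k)
  rw [add_sub_cancel] at hgrad hhess
  exact stationarity_le hL (norm_nonneg _) hgrad hhess

theorem apply_le (k : ℕ) : g x (y k) ≤ g x y₀ := by
  have hsum := hh.sum_norm_step_pow_le hrun.isCubicStep k
  have hnonneg : 0 ≤ ∑ j ∈ Finset.range k, L / 12 * ‖y (j + 1) - y j‖ ^ 3 :=
    Finset.sum_nonneg fun j _ => by positivity
  rw [hrun.1] at hsum
  linarith

theorem apply_output_le {K : ℕ} {yhat : Vec m} (hout : IsCubicNewtonOutput L g x y K yhat) :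
    g x yhat ≤ g x y₀ := by
  obtain ⟨k, -, rfl, -⟩ := hout
  exact hrun.apply_le hh hL k

theorem apply_le_of_mapClusterPt {p : Vec m} (hp : MapClusterPt p atTop y) : g x p ≤ g x y₀ := by
  obtain ⟨φ, -, hlim⟩ := hp.tendsto_subseq
  exact le_of_tendsto ((hh.grad p).continuousAt.tendsto.comp hlim)
    (Eventually.of_forall fun k => hrun.apply_le hh hL (φ k))

theorem mul_stationarity_pow_le {K : ℕ} {yhat : Vec m} (hout : IsCubicNewtonOutput L g x y K yhat) :
    L / 12 * K * stationarity L g x yhat ^ 3 ≤ g x y₀ - g x (y K) := by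
  obtain ⟨k, -, rfl, hmin⟩ := hout
  calc L / 12 * K * stationarity L g x (y k) ^ 3
      = ∑ j ∈ Finset.range K, L / 12 * stationarity L g x (y k) ^ 3 := by
        rw [Finset.sum_const, Finset.card_range, nsmul_eq_mul]
        ring
    _ ≤ ∑ j ∈ Finset.range K, L / 12 * ‖y (j + 1) - y j‖ ^ 3 := by
        refine Finset.sum_le_sum fun j hj => ?_
        have hle := (hmin (j + 1) (Finset.mem_range.1 hj)).trans
          (hrun.stationarity_succ_le hh hL j)
        have hnonneg := stationarity_nonneg L g x (y k)
        gcongr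
    _ ≤ g x y₀ - g x (y K) := hrun.1 ▸ hh.sum_norm_step_pow_le hrun.isCubicStep K

theorem norm_sub_output_le (hgBar : g x y₀ ≤ gBar) (hgLow : ∀ y, gLow ≤ g x y)
    (hlevel : {y | g x y ≤ g x y₀} ⊆ Y) (hY' : IsCompact Y') (hμ : 0 < μ)
    (heig : ∀ y ∈ Y', gradY g x y = 0 →
      ∀ l : ℝ, Module.End.HasEigenvalue (hessY g x y : Vec m →ₗ[ℝ] Vec m) l → μ ≤ |l|)
    (ha : 0 < a)
    (hgrad : ∀ y ∈ Y \ Metric.cthickening (μ / (2 * L)) (critSet g Y' x), a ≤ ‖gradY g x y‖)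
    (hρ : 0 < ρ) {K : ℕ} (hK : iterBound₁ gBar gLow L μ a + iterBound₂ gBar gLow L μ ρ < K)
    {yhat p : Vec m} (hout : IsCubicNewtonOutput L g x y K yhat) (hp : MapClusterPt p atTop y) :
    ‖p - yhat‖ ≤ ρ := by
  obtain ⟨hmin, hstat, hacc⟩ := bounds_of_iterBound_lt hL ha hμ hρ (stationarity_nonneg L g x yhat)
    K.cast_nonneg
    ((hrun.mul_stationarity_pow_le hh hL hout).trans (sub_le_sub hgBar (hgLow _))) hK
  have hstationary := norm_gradY_le_stationarity (g := g) (x := x) hL yhat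
  have hbelow : yhat ∈ Y := hlevel (hrun.apply_output_le hh hL hout)
  obtain ⟨k, -, rfl, -⟩ := hout
  have hcont : Continuous (gradY g x) :=
    continuous_iff_continuousAt.2 fun y => (hh.hess y).continuousAt
  have hsmall : ‖gradY g x (y k)‖ < a := by linarith [min_le_left a (μ ^ 2 / (4 * L))]
  obtain ⟨q, ⟨hqY', hq⟩, hdist⟩ := exists_mem_critSet_norm_sub_le hcont hY' (by positivity) hgrad
    hbelow hsmall
  have hpos := hh.mul_norm_sq_le_inner_near hL hμ (heig q hqY' hq) hdist hstat
  have hlim : Tendsto y atTop (𝓝 q) := by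
    refine hh.tendsto_of_near hL hpos hμ hq hrun.isCubicStep hdist ?_
    calc ‖gradY g x (y k)‖ ≤ 9 / 16 * (μ ^ 2 / (4 * L)) := by
          linarith [min_le_right a (μ ^ 2 / (4 * L))]
      _ = 9 / 64 * (μ ^ 2 / L) := by ring
  obtain ⟨φ, hφ, hsub⟩ := hp.tendsto_subseq
  obtain rfl : p = q := tendsto_nhds_unique hsub (hlim.comp hφ.tendsto_atTop)
  rw [norm_sub_rev]
  refine le_of_mul_le_mul_left ?_ hμ
  linarith [hh.norm_sub_le_norm_grad hL hpos hq hdist, mul_pos hμ hρ]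

end IsCubicNewtonRun

end Output

section Kernel

variable {n : ℕ} {ξ : ℝ}

theorem hasGradientAt_gaussKernel (ξ : ℝ) (z : Vec n) :
    HasGradientAt (gaussKernel ξ) (-(gaussKernel ξ z / ξ ^ 2) • z) z := by
  have hexponent := (hasStrictFDerivAt_norm_sq z).hasFDerivAt.neg.mul_const (2 * ξ ^ 2)⁻¹
  have hexp := hexponent.exp.const_mul (1 / (2 * Real.pi * ξ ^ 2) ^ ((n : ℝ) / 2))
  refine hasGradientAt_iff_hasFDerivAt.2 (hexp.congr_fderiv ?_)
  ext v
  simp only [div_eq_mul_inv, one_mul, Pi.neg_apply, mul_inv_rev, neg_mul, smul_neg, neg_apply,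
    smul_apply, coe_innerSL_apply, nsmul_eq_mul, Nat.cast_ofNat, smul_eq_mul, gaussKernel, neg_smul,
    map_neg, map_smul, InnerProductSpace.toDual_apply_apply, neg_inj]
  ring

theorem gradient_gaussKernel (ξ : ℝ) :
    gradient (gaussKernel ξ) = fun z : Vec n => -(gaussKernel ξ z / ξ ^ 2) • z :=
  gradient_eq (hasGradientAt_gaussKernel ξ)

theorem continuous_gaussKernel (ξ : ℝ) : Continuous (gaussKernel ξ : Vec n → ℝ) := by
  unfold gaussKernel
  fun_prop

theorem continuous_gradient_gaussKernel (ξ : ℝ) :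
    Continuous (gradient (gaussKernel ξ : Vec n → ℝ)) := by
  rw [gradient_gaussKernel]
  exact ((continuous_gaussKernel ξ).div_const _).neg.smul continuous_id

/-- A bound of the gradient of the Gaussian kernel `h_ξ` on `ℝⁿ`. It exceeds the supremum by a
factor chosen such that it also bounds `‖∇h_ξ(z)‖ exp(‖z‖² / (4 ξ²))`. -/
noncomputable def gaussGradBound (n : ℕ) (ξ : ℝ) : ℝ :=
  1 / (2 * Real.pi * ξ ^ 2) ^ ((n : ℝ) / 2) / ξ ^ 2 * (1 + 2 * ξ ^ 2)

theorem gaussGradBound_nonneg (n : ℕ) (ξ : ℝ) : 0 ≤ gaussGradBound n ξ := by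
  unfold gaussGradBound
  positivity

theorem le_mul_exp_sq (hξ : 0 < ξ) (t : ℝ) :
    t ≤ (1 + 2 * ξ ^ 2) * Real.exp (1 / (4 * ξ ^ 2) * t ^ 2) :=
  calc t ≤ (1 + 2 * ξ ^ 2) * (1 / (4 * ξ ^ 2) * t ^ 2 + 1) := by
        have hexpand : (1 + 2 * ξ ^ 2) * (1 / (4 * ξ ^ 2) * t ^ 2 + 1) =
            1 / (4 * ξ ^ 2) * t ^ 2 + 2 * ξ ^ 2 + (1 + t ^ 2 / 2) := by
          field_simp
          ring
        have hnonneg : 0 ≤ 1 / (4 * ξ ^ 2) * t ^ 2 + 2 * ξ ^ 2 := by positivity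
        rw [hexpand]
        linarith [sq_nonneg (t - 1)]
    _ ≤ (1 + 2 * ξ ^ 2) * Real.exp (1 / (4 * ξ ^ 2) * t ^ 2) := by
        gcongr
        exact Real.add_one_le_exp _

theorem norm_gradient_gaussKernel_le_mul_exp (hξ : 0 < ξ) (z : Vec n) :
    ‖gradient (gaussKernel ξ) z‖ ≤
      gaussGradBound n ξ * Real.exp (-(1 / (4 * ξ ^ 2)) * ‖z‖ ^ 2) := by
  set c := 1 / (2 * Real.pi * ξ ^ 2) ^ ((n : ℝ) / 2)
  have hexp : Real.exp (-‖z‖ ^ 2 / (2 * ξ ^ 2)) * Real.exp (1 / (4 * ξ ^ 2) * ‖z‖ ^ 2) =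
      Real.exp (-(1 / (4 * ξ ^ 2)) * ‖z‖ ^ 2) := by
    rw [← Real.exp_add]
    congr 1
    field_simp
    ring
  calc ‖gradient (gaussKernel ξ) z‖ = c * Real.exp (-‖z‖ ^ 2 / (2 * ξ ^ 2)) / ξ ^ 2 * ‖z‖ := by
        rw [gradient_gaussKernel, norm_smul, norm_neg, gaussKernel,
          Real.norm_of_nonneg (by positivity)]
    _ ≤ c * Real.exp (-‖z‖ ^ 2 / (2 * ξ ^ 2)) / ξ ^ 2 *
        ((1 + 2 * ξ ^ 2) * Real.exp (1 / (4 * ξ ^ 2) * ‖z‖ ^ 2)) := by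
        gcongr
        exact le_mul_exp_sq hξ ‖z‖
    _ = c / ξ ^ 2 * (1 + 2 * ξ ^ 2) *
        (Real.exp (-‖z‖ ^ 2 / (2 * ξ ^ 2)) * Real.exp (1 / (4 * ξ ^ 2) * ‖z‖ ^ 2)) := by ring
    _ = gaussGradBound n ξ * Real.exp (-(1 / (4 * ξ ^ 2)) * ‖z‖ ^ 2) := by
        rw [hexp, gaussGradBound]

theorem norm_gradient_gaussKernel_le (hξ : 0 < ξ) (z : Vec n) :
    ‖gradient (gaussKernel ξ) z‖ ≤ gaussGradBound n ξ := by
  refine (norm_gradient_gaussKernel_le_mul_exp hξ z).trans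
    (mul_le_of_le_one_right (gaussGradBound_nonneg n ξ) (Real.exp_le_one_iff.2 ?_))
  rw [neg_mul]
  exact neg_nonpos.2 (by positivity)

theorem integrable_exp_neg_mul_norm_sq {V : Type*} [NormedAddCommGroup V] [InnerProductSpace ℝ V]
    [FiniteDimensional ℝ V] [MeasurableSpace V] [BorelSpace V] {b : ℝ} (hb : 0 < b) :
    Integrable fun z : V => Real.exp (-b * ‖z‖ ^ 2) := by
  have hcexp := (GaussianFourier.integrable_cexp_neg_mul_sq_norm_add (b := (b : ℂ)) (V := V)
    (by simpa using hb) 0 0).norm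
  simpa [Complex.norm_exp, ← Complex.ofReal_pow] using hcexp

theorem integrable_gaussKernel (hξ : 0 < ξ) : Integrable (gaussKernel ξ : Vec n → ℝ) := by
  refine ((integrable_exp_neg_mul_norm_sq (V := Vec n) (b := 1 / (2 * ξ ^ 2))
    (by positivity)).const_mul (1 / (2 * Real.pi * ξ ^ 2) ^ ((n : ℝ) / 2))).congr
    (Eventually.of_forall fun z => ?_)
  simp only [gaussKernel]
  congr 2
  ring

theorem integrable_gradient_gaussKernel (hξ : 0 < ξ) :
    Integrable (gradient (gaussKernel ξ : Vec n → ℝ)) :=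
  ((integrable_exp_neg_mul_norm_sq (b := 1 / (4 * ξ ^ 2)) (by positivity)).const_mul _).mono'
    (continuous_gradient_gaussKernel ξ).aestronglyMeasurable
    (Eventually.of_forall (norm_gradient_gaussKernel_le_mul_exp hξ))

theorem exp_neg_mul_norm_sq_le {V : Type*} [SeminormedAddCommGroup V] {b : ℝ} (hb : 0 ≤ b)
    {v w : V} (hvw : ‖w - v‖ ≤ 1) :
    Real.exp (-(2 * b) * ‖v‖ ^ 2) ≤ Real.exp (2 * b) * Real.exp (-b * ‖w‖ ^ 2) := by
  have hnorm : ‖w‖ ≤ ‖v‖ + 1 := (norm_le_norm_add_norm_sub' w v).trans (by gcongr)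
  have hsq : ‖w‖ ^ 2 ≤ 2 * ‖v‖ ^ 2 + 2 := by
    linarith [pow_le_pow_left₀ (norm_nonneg w) hnorm 2, sq_nonneg (‖v‖ - 1)]
  rw [← Real.exp_add, Real.exp_le_exp]
  linarith [mul_le_mul_of_nonneg_left hsq hb]

theorem exists_integrable_norm_gradient_gaussKernel_sub_le (hξ : 0 < ξ) (x : Vec n) :
    ∃ bound : Vec n → ℝ, Integrable bound ∧
      ∀ x' ∈ Metric.ball x 1, ∀ z, ‖gradient (gaussKernel ξ) (x' - z)‖ ≤ bound z := by
  set b := 1 / (8 * ξ ^ 2) with hb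
  have hb₀ : 0 < b := by positivity
  refine ⟨fun z => gaussGradBound n ξ * (Real.exp (2 * b) * Real.exp (-b * ‖x - z‖ ^ 2)),
    (((integrable_exp_neg_mul_norm_sq hb₀).comp_sub_left x).const_mul _).const_mul _,
    fun x' hx' z => (norm_gradient_gaussKernel_le_mul_exp hξ _).trans
      (mul_le_mul_of_nonneg_left ?_ (gaussGradBound_nonneg n ξ))⟩
  have hrate : 1 / (4 * ξ ^ 2) = 2 * b := by
    rw [hb]
    field_simp
    norm_num
  rw [hrate]
  refine exp_neg_mul_norm_sq_le hb₀.le ?_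
  rw [sub_sub_sub_cancel_right, norm_sub_rev, ← dist_eq_norm]
  exact (Metric.mem_ball.1 hx').le

section Convolution

variable {φ : Vec n → ℝ} {C : ℝ} (hξ : 0 < ξ) (hφ : AEStronglyMeasurable φ volume)
  (hC : ∀ z, |φ z| ≤ C)
include hξ hφ hC

theorem integrable_smul_gradient_gaussKernel (x : Vec n) :
    Integrable fun z => φ z • gradient (gaussKernel ξ) (x - z) :=
  ((integrable_gradient_gaussKernel hξ).comp_sub_left x).bdd_smul C hφ (Eventually.of_forall hC)

theorem hasGradientAt_gaussSmooth (x : Vec n) :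
    HasGradientAt (gaussSmooth ξ φ) (kernelGradIntegral ξ φ x) x := by
  obtain ⟨bound, hbound, hle⟩ := exists_integrable_norm_gradient_gaussKernel_sub_le hξ x
  have hint := integrable_smul_gradient_gaussKernel hξ hφ hC x
  have hderiv (z x' : Vec n) : HasFDerivAt (fun x' => gaussKernel ξ (x' - z) * φ z)
      (innerSL ℝ (φ z • gradient (gaussKernel ξ) (x' - z))) x' := by
    have hgrad := (hasGradientAt_gaussKernel ξ (x' - z)).hasFDerivAt
    rw [← congrFun (gradient_gaussKernel ξ)] at hgrad
    refine ((hgrad.comp x' ((hasFDerivAt_id x').sub_const z)).mul_const (φ z)).congr_fderiv ?_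
    ext v
    simp
  have hintegral := hasFDerivAt_integral_of_dominated_of_fderiv_le (μ := volume)
    (F := fun x' z => gaussKernel ξ (x' - z) * φ z) (bound := fun z => C * bound z)
    (Metric.ball_mem_nhds x one_pos)
    (Eventually.of_forall fun x' =>
      ((continuous_gaussKernel ξ).comp (continuous_sub_left x')).aestronglyMeasurable.mul hφ)
    (((integrable_gaussKernel hξ).comp_sub_left x).mul_bdd hφ (Eventually.of_forall hC))
    ((innerSL ℝ).continuous.comp_aestronglyMeasurable hint.aestronglyMeasurable)
    (Eventually.of_forall fun z x' hx' => ?_) (hbound.const_mul C)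
    (Eventually.of_forall fun z x' _ => hderiv z x')
  · rw [(innerSL ℝ).integral_comp_comm hint] at hintegral
    exact hasGradientAt_iff_hasFDerivAt.2 hintegral
  · rw [innerSL_apply_norm, norm_smul]
    exact mul_le_mul (hC z) (hle x' hx' z) (norm_nonneg _) ((abs_nonneg _).trans (hC z))

theorem norm_kernelGradIntegral_sub_le {ψ : Vec n → ℝ} (hψ : AEStronglyMeasurable ψ volume)
    (hψC : ∀ z, |ψ z| ≤ C) {S : Set (Vec n)} (hS : MeasurableSet S) (hSfin : volume S ≠ ⊤)
    {A B : ℝ} (hB : 0 ≤ B) (hAB : ∀ z, |φ z - ψ z| ≤ A + S.indicator (fun _ => B) z) (x : Vec n) :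
    ‖kernelGradIntegral ξ φ x - kernelGradIntegral ξ ψ x‖ ≤
      A * (∫ z : Vec n, ‖gradient (gaussKernel ξ) z‖) +
        gaussGradBound n ξ * (B * volume.real S) := by
  have hgrad := ((integrable_gradient_gaussKernel (n := n) hξ).comp_sub_left x).norm
  have hind : Integrable (S.indicator fun _ : Vec n => B) volume :=
    (integrable_indicator_iff hS).2 (integrableOn_const hSfin)
  have hpointwise (z : Vec n) : ‖φ z • gradient (gaussKernel ξ) (x - z) -
      ψ z • gradient (gaussKernel ξ) (x - z)‖ ≤
      A * ‖gradient (gaussKernel ξ) (x - z)‖ +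
        gaussGradBound n ξ * S.indicator (fun _ => B) z := by
    have hkernel := mul_le_mul_of_nonneg_left (norm_gradient_gaussKernel_le hξ (x - z))
      (indicator_nonneg (fun _ _ => hB) z : 0 ≤ S.indicator (fun _ => B) z)
    rw [← sub_smul, norm_smul, Real.norm_eq_abs]
    linarith [mul_le_mul_of_nonneg_right (hAB z) (norm_nonneg (gradient (gaussKernel ξ) (x - z)))]
  calc ‖kernelGradIntegral ξ φ x - kernelGradIntegral ξ ψ x‖
      = ‖∫ z, φ z • gradient (gaussKernel ξ) (x - z) - ψ z • gradient (gaussKernel ξ) (x - z)‖ := by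
        rw [integral_sub (integrable_smul_gradient_gaussKernel hξ hφ hC x)
          (integrable_smul_gradient_gaussKernel hξ hψ hψC x), kernelGradIntegral,
          kernelGradIntegral]
    _ ≤ ∫ z, A * ‖gradient (gaussKernel ξ) (x - z)‖ +
          gaussGradBound n ξ * S.indicator (fun _ => B) z :=
        norm_integral_le_of_norm_le ((hgrad.const_mul A).add (hind.const_mul _))
          (Eventually.of_forall hpointwise)
    _ = A * (∫ z : Vec n, ‖gradient (gaussKernel ξ) z‖) +
          gaussGradBound n ξ * (B * volume.real S) := by
        rw [integral_add (hgrad.const_mul A) (hind.const_mul _), integral_const_mul,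
          integral_const_mul,
          integral_sub_left_eq_self (fun z : Vec n => ‖gradient (gaussKernel ξ) z‖),
          integral_indicator_const _ hS, smul_eq_mul, mul_comm B]

end Convolution

end Kernel

section RegularFibers

theorem hasLipschitzHessian_of_contDiff {E : Type*} [NormedAddCommGroup E] [InnerProductSpace ℝ E]
    [CompleteSpace E] {h : E → ℝ} {L : ℝ} (hh : ContDiff ℝ 2 h)
    (hlip : ∀ y y', ‖fderiv ℝ (gradient h) y - fderiv ℝ (gradient h) y'‖ ≤ L * ‖y - y'‖) :
    HasLipschitzHessian h (gradient h) (fderiv ℝ (gradient h)) L where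
  grad y := (hh.differentiable two_ne_zero y).hasGradientAt
  hess y := by
    let riesz : StrongDual ℝ E ≃L[ℝ] E :=
      (InnerProductSpace.toDual ℝ E).symm.toContinuousLinearEquiv
    have hgrad : Differentiable ℝ (gradient h) := riesz.differentiable.comp
      ((hh.fderiv_right one_add_one_eq_two.le).differentiable one_ne_zero)
    exact (hgrad y).hasFDerivAt
  lip := hlip

variable {n m : ℕ} {f g : Vec n → Vec m → ℝ} {X : Set (Vec n)} {Y : Set (Vec m)}
  {y₀ : Vec m} {gLow L : ℝ}

theorem pairDist_self_left (x : Vec n) (y y' : Vec m) : pairDist x x y y' = ‖y - y'‖ := by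
  simp [pairDist]

theorem continuousOn_gradY_of_hasFDerivWithinAt {D : Vec n × Vec m → (Vec n × Vec m →L[ℝ] ℝ)}
    (hD : ∀ p ∈ X ×ˢ (univ : Set (Vec m)),
      HasFDerivWithinAt (fun p : Vec n × Vec m => g p.1 p.2) (D p) (X ×ˢ univ) p)
    (hcont : ContinuousOn D (X ×ˢ univ)) :
    ContinuousOn (fun p : Vec n × Vec m => gradY g p.1 p.2) (X ×ˢ univ) := by
  have hgrad : ∀ p ∈ X ×ˢ (univ : Set (Vec m)), gradY g p.1 p.2 =
      (InnerProductSpace.toDual ℝ (Vec m)).symm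
        ((D p).comp (ContinuousLinearMap.inr ℝ (Vec n) (Vec m))) := fun ⟨x, y⟩ hp => by
    have hslice := (hD _ hp).comp_hasFDerivAt y (hasFDerivAt_prodMk_right x y)
      (Eventually.of_forall fun v => ⟨hp.1, mem_univ _⟩)
    exact hslice.hasGradientAt.gradient
  exact ((InnerProductSpace.toDual ℝ (Vec m)).symm.continuous.comp_continuousOn
    (hcont.clm_comp continuousOn_const)).congr hgrad

theorem continuousOn_hessY_of_lipschitz
    (hlip : ∀ x ∈ X, ∀ x' ∈ X, ∀ y y' : Vec m,
      ‖hessY g x y - hessY g x' y'‖ ≤ L * pairDist x x' y y') :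
    ContinuousOn (fun p : Vec n × Vec m => hessY g p.1 p.2) (X ×ˢ univ) := by
  rintro ⟨x, y⟩ hp
  rw [ContinuousWithinAt, tendsto_iff_norm_sub_tendsto_zero]
  have hcont : Continuous fun q : Vec n × Vec m => L * pairDist q.1 x q.2 y := by
    unfold pairDist
    fun_prop
  have hlim := (hcont.tendsto (x, y)).mono_left (nhdsWithin_le_nhds (s := X ×ˢ univ))
  rw [pairDist_self_left, sub_self, norm_zero, mul_zero] at hlim
  refine squeeze_zero' (Eventually.of_forall fun _ => norm_nonneg _) ?_ hlim
  filter_upwards [self_mem_nhdsWithin] with q hq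
  exact hlip _ hq.1 _ hp.1 _ _

theorem StandingAssumptions.hasRegularFibers (hstd : StandingAssumptions f g X Y y₀ gLow L) :
    HasRegularFibers g X L where
  hasLipschitzHessian x hx := by
    refine hasLipschitzHessian_of_contDiff ?_ fun y y' => ?_
    · exact contDiffOn_univ.1 (hstd.g_contDiff.comp (f := fun y : Vec m => (x, y)) (by fun_prop)
        fun y _ => ⟨hx, mem_univ _⟩)
    · exact pairDist_self_left x y y' ▸ hstd.hess_lipschitz x hx x hx y y'
  continuousOn_gradY := by
    obtain ⟨D, Lg, hD, hlip⟩ := hstd.g_lipschitz_smooth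
    exact continuousOn_gradY_of_hasFDerivWithinAt hD hlip.continuousOn
  continuousOn_hessY := continuousOn_hessY_of_lipschitz hstd.hess_lipschitz

end RegularFibers

section Comparison

theorem aestronglyMeasurable_restrict_of_continuousWithinAt_ae {α β : Type*} [TopologicalSpace α]
    [MeasurableSpace α] [OpensMeasurableSpace α] [TopologicalSpace β]
    [TopologicalSpace.PseudoMetrizableSpace β] [SecondCountableTopologyEither α β]
    {ν : Measure α} {X : Set α} (hX : MeasurableSet X) {φ : α → β}
    (hφ : ν {z ∈ X | ¬ ContinuousWithinAt φ X z} = 0) :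
    AEStronglyMeasurable φ (ν.restrict X) := by
  set N := toMeasurable ν {z ∈ X | ¬ ContinuousWithinAt φ X z}
  have hcont : ContinuousOn φ (X \ N) := fun z hz => by
    by_contra hdisc
    exact hz.2 (subset_toMeasurable _ _ ⟨hz.1, fun h => hdisc (h.mono sdiff_subset)⟩)
  have hN : ν N = 0 := (measure_toMeasurable _).trans hφ
  rw [← Measure.restrict_congr_set (sdiff_null_ae_eq_self hN)]
  exact hcont.aestronglyMeasurable (hX.diff (measurableSet_toMeasurable _ _))

variable {n m : ℕ} {f g : Vec n → Vec m → ℝ} {X : Set (Vec n)} {y₀ : Vec m} {fBar : ℝ}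

theorem aestronglyMeasurable_extendedValue (hX : MeasurableSet X) {w : Vec n → Vec m}
    (hw : AEStronglyMeasurable (fun z => f z (w z)) (volume.restrict X)) :
    AEStronglyMeasurable (extendedValue f X fBar w) volume := by
  classical
  exact hw.piecewise hX aestronglyMeasurable_const

theorem aestronglyMeasurable_extendedValue_of_volume_eq_zero (hX : MeasurableSet X)
    {D : Set (Vec n × Vec m)} (hf : ContinuousOn (fun p : Vec n × Vec m => f p.1 p.2) D)
    {w : Vec n → Vec m} (hw : ∀ z ∈ X, (z, w z) ∈ D) {B : Set (Vec n)} (hB : volume B = 0)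
    (hdisc : volume {z | z ∈ X \ B ∧ ¬ ContinuousWithinAt w X z} = 0) :
    AEStronglyMeasurable (extendedValue f X fBar w) volume := by
  refine aestronglyMeasurable_extendedValue hX
    (aestronglyMeasurable_restrict_of_continuousWithinAt_ae hX
      (measure_mono_null ?_ (measure_union_null hdisc hB)))
  rintro z ⟨hz, hfw⟩
  by_cases hzB : z ∈ B
  · exact Or.inr hzB
  · refine Or.inl ⟨⟨hz, hzB⟩, fun hwz => hfw ?_⟩
    exact ContinuousWithinAt.comp (f := fun z => (z, w z)) (hf _ (hw z hz))
      (continuousWithinAt_id.prodMk hwz) hw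

theorem abs_extendedValue_le {w : Vec n → Vec m} (hw : ∀ z ∈ X, |f z (w z)| ≤ fBar) (z : Vec n) :
    |extendedValue f X fBar w z| ≤ |fBar| := by
  rw [extendedValue]
  split_ifs with hz
  · exact (hw z hz).trans (le_abs_self _)
  · exact le_rfl

theorem abs_extendedValue_sub_le {v w : Vec n → Vec m} (hv : ∀ z ∈ X, |f z (v z)| ≤ fBar)
    (hw : ∀ z ∈ X, |f z (w z)| ≤ fBar) {S : Set (Vec n)} {r : ℝ} (hr : 0 ≤ r)
    (hclose : ∀ z ∈ X \ S, |f z (v z) - f z (w z)| ≤ r) (z : Vec n) :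
    |extendedValue f X fBar v z - extendedValue f X fBar w z| ≤
      r + S.indicator (fun _ => 2 * |fBar|) z := by
  by_cases hzS : z ∈ S
  · rw [indicator_of_mem hzS]
    linarith [abs_sub (extendedValue f X fBar v z) (extendedValue f X fBar w z),
      abs_extendedValue_le hv z, abs_extendedValue_le hw z]
  · rw [indicator_of_notMem hzS, add_zero, extendedValue, extendedValue]
    split_ifs with hzX
    · exact hclose z ⟨hzX, hzS⟩
    · rwa [sub_self, abs_zero]

theorem norm_gradient_gaussSmooth_extendedValue_sub_le {ξ : ℝ} (hξ : 0 < ξ) {v w : Vec n → Vec m}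
    (hv_meas : AEStronglyMeasurable (extendedValue f X fBar v) volume)
    (hw_meas : AEStronglyMeasurable (extendedValue f X fBar w) volume)
    (hv : ∀ z ∈ X, |f z (v z)| ≤ fBar) (hw : ∀ z ∈ X, |f z (w z)| ≤ fBar) {S : Set (Vec n)}
    (hS : MeasurableSet S) (hSfin : volume S ≠ ⊤) {r : ℝ} (hr : 0 ≤ r)
    (hclose : ∀ z ∈ X \ S, |f z (v z) - f z (w z)| ≤ r) (x : Vec n) :
    ‖gradient (gaussSmooth ξ (extendedValue f X fBar v)) x -
        kernelGradIntegral ξ (extendedValue f X fBar w) x‖ ≤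
      r * (∫ z : Vec n, ‖gradient (gaussKernel ξ) z‖) +
        gaussGradBound n ξ * (2 * |fBar| * volume.real S) := by
  rw [(hasGradientAt_gaussSmooth hξ hv_meas (abs_extendedValue_le hv) x).gradient]
  exact norm_kernelGradIntegral_sub_le hξ hv_meas (abs_extendedValue_le hv) hw_meas
    (abs_extendedValue_le hw) hS hSfin (by positivity) (abs_extendedValue_sub_le hv hw hr hclose) x

theorem measurableSet_bifurcationNhd (hX : MeasurableSet X) (δ : ℝ) :
    MeasurableSet (bifurcationNhd g X δ) :=
  hX.inter Metric.isClosed_cthickening.measurableSet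

theorem IsCubicNewtonRun.norm_sub_output_le_of_notMem_bifurcationNhd {Y Y' : Set (Vec m)}
    {gLow gBar L δ ρ : ℝ} {μ : ℝ → ℝ} {α : ℝ → ℝ → ℝ} (hg : HasRegularFibers g X L) (hL : 0 < L)
    (hY' : IsCompact Y') (hμ : IsEigenvalueBound g X Y' μ) (hα : IsGradientBound g X Y Y' α)
    (hδ : 0 < δ) (hρ : 0 < ρ) {K : ℕ}
    (hK : iterBound₁ gBar gLow L (μ δ) (α δ (μ δ / (2 * L))) + iterBound₂ gBar gLow L (μ δ) ρ < K)
    {z : Vec n} (hz : z ∈ X \ bifurcationNhd g X δ) (hgBar : g z y₀ ≤ gBar)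
    (hgLow : ∀ y, gLow ≤ g z y) (hlevel : {y | g z y ≤ g z y₀} ⊆ Y) {y : ℕ → Vec m}
    (hrun : IsCubicNewtonRun L g y₀ z y) {yhat p : Vec m}
    (hout : IsCubicNewtonOutput L g z y K yhat) (hp : MapClusterPt p atTop y) : ‖p - yhat‖ ≤ ρ := by
  obtain ⟨hμδ, heig⟩ := hμ δ hδ
  obtain ⟨hαδ, hgrad⟩ := hα δ hδ (μ δ / (2 * L)) (by positivity)
  exact hrun.norm_sub_output_le (hg.hasLipschitzHessian z hz.1) hL hgBar hgLow hlevel hY' hμδ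
    (heig z hz) hαδ (hgrad z hz) hρ hK hout hp

end Comparison

end SmoothedBilevel

open SmoothedBilevel in
theorem mainTheorem9_general {n m : ℕ} {f g : Vec n → Vec m → ℝ} {X : Set (Vec n)}
    {Y Y' : Set (Vec m)} {y₀ : Vec m} {gLow gBar L Lf fBar : ℝ} (hX : IsCompact X)
    (hf : ContinuousOn (fun p : Vec n × Vec m => f p.1 p.2) {p | p.1 ∈ X ∧ g p.1 p.2 ≤ g p.1 y₀})
    (hg : HasRegularFibers g X L) (hL : 0 < L) (hgLow : ∀ x ∈ X, ∀ y, gLow ≤ g x y)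
    (hgBar : ∀ x ∈ X, g x y₀ ≤ gBar) (hlevel : ∀ x ∈ X, {y | g x y ≤ g x y₀} ⊆ Y)
    (hLf : ∀ x ∈ X, ∀ y y', g x y ≤ g x y₀ → g x y' ≤ g x y₀ → |f x y - f x y'| ≤ Lf * ‖y - y'‖)
    (hfBar : ∀ x ∈ X, ∀ y, g x y ≤ g x y₀ → |f x y| ≤ fBar) (hY : IsCompact Y)
    (hY' : IsCompact Y') (hYY' : Y ⊆ interior Y')
    (hdim : upperMinkowskiDim (bifurcationSet g X) < n) :
    (∃ (μ : ℝ → ℝ) (α : ℝ → ℝ → ℝ), IsEigenvalueBound g X Y' μ ∧ IsGradientBound g X Y Y' α) ∧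
    ∃ C₁ C₂ : ℝ → ℝ, ∀ (run : Vec n → ℕ → Vec m) (p : Vec n → Vec m),
      (∀ z ∈ X, IsCubicNewtonRun L g y₀ z (run z)) →
      (∀ z ∈ X, MapClusterPt (p z) atTop (run z)) →
      volume {z | z ∈ X \ bifurcationSet g X ∧ ¬ ContinuousWithinAt p X z} = 0 →
      ∀ (μ : ℝ → ℝ) (α : ℝ → ℝ → ℝ), IsEigenvalueBound g X Y' μ → IsGradientBound g X Y Y' α →
      ∀ (ξ ρ δ : ℝ) (K : ℕ), 0 < ξ → 0 < ρ → 0 < δ →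
      iterBound₁ gBar gLow L (μ δ) (α δ (μ δ / (2 * L))) + iterBound₂ gBar gLow L (μ δ) ρ < K →
      ∀ yhat : Vec n → Vec m, (∀ z ∈ X, IsCubicNewtonOutput L g z (run z) K (yhat z)) →
      AEStronglyMeasurable (fun z => f z (yhat z)) (volume.restrict X) →
      ∀ x : Vec n,
        DifferentiableAt ℝ (gaussSmooth ξ (extendedValue f X fBar p)) x ∧
        Integrable (fun z => extendedValue f X fBar yhat z • gradient (gaussKernel ξ) (x - z)) ∧
        ‖gradient (gaussSmooth ξ (extendedValue f X fBar p)) x -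
            kernelGradIntegral ξ (extendedValue f X fBar yhat) x‖ ≤
          C₁ ξ * ρ + C₂ ξ * δ ^ (((n : ℝ) - upperMinkowskiDim (bifurcationSet g X)) / 2) := by
  have hB : Bornology.IsBounded (bifurcationSet g X) := hX.isBounded.subset (sep_subset _ _)
  obtain ⟨μ₀, hμ₀⟩ := hg.exists_isEigenvalueBound hX hY'
  obtain ⟨α₀, hα₀⟩ := hg.exists_isGradientBound hX hY hYY'
  obtain ⟨V, hV⟩ := exists_volume_inter_cthickening_le hB hX.isBounded hdim
  refine ⟨⟨μ₀, α₀, hμ₀, hα₀⟩, fun ξ => |Lf| * ∫ z : Vec n, ‖gradient (gaussKernel ξ) z‖,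
    fun ξ => gaussGradBound n ξ * (2 * |fBar|) * V, ?_⟩
  intro run p hrun hp hdisc μ α hμ hα ξ ρ δ K hξ hρ hδ hK yhat hyhat hyhat_meas x
  have hp_level z hz := (hrun z hz).apply_le_of_mapClusterPt (hg.hasLipschitzHessian z hz) hL
    (hp z hz)
  have hyhat_level z hz := (hrun z hz).apply_output_le (hg.hasLipschitzHessian z hz) hL
    (hyhat z hz)
  have hp_bd z hz := hfBar z hz _ (hp_level z hz)
  have hyhat_bd z hz := hfBar z hz _ (hyhat_level z hz)
  have hp_meas : AEStronglyMeasurable (extendedValue f X fBar p) volume :=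
    aestronglyMeasurable_extendedValue_of_volume_eq_zero hX.measurableSet hf
      (fun z hz => ⟨hz, hp_level z hz⟩) (volume_eq_zero_of_upperMinkowskiDim_lt hB hdim) hdisc
  replace hyhat_meas : AEStronglyMeasurable (extendedValue f X fBar yhat) volume :=
    aestronglyMeasurable_extendedValue hX.measurableSet hyhat_meas
  have hclose : ∀ z ∈ X \ bifurcationNhd g X δ, |f z (p z) - f z (yhat z)| ≤ |Lf| * ρ := by
    intro z hz
    have hdist := (hrun z hz.1).norm_sub_output_le_of_notMem_bifurcationNhd hg hL hY' hμ hα hδ hρ hK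
      hz (hgBar z hz.1) (hgLow z hz.1) (hlevel z hz.1) (hyhat z hz.1) (hp z hz.1)
    exact (hLf z hz.1 _ _ (hp_level z hz.1) (hyhat_level z hz.1)).trans
      (mul_le_mul (le_abs_self _) hdist (norm_nonneg _) (abs_nonneg _))
  have hcompare := norm_gradient_gaussSmooth_extendedValue_sub_le hξ hp_meas hyhat_meas hp_bd
    hyhat_bd (measurableSet_bifurcationNhd hX.measurableSet δ)
    (hX.isBounded.subset inter_subset_left).measure_lt_top.ne (by positivity) hclose x
  refine ⟨(hasGradientAt_gaussSmooth hξ hp_meas (abs_extendedValue_le hp_bd) x).differentiableAt,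
    integrable_smul_gradient_gaussKernel hξ hyhat_meas (abs_extendedValue_le hyhat_bd) x,
    hcompare.trans ?_⟩
  have hvolume := mul_le_mul_of_nonneg_left (hV δ hδ)
    (mul_nonneg (gaussGradBound_nonneg n ξ) (by positivity : 0 ≤ 2 * |fBar|))
  rw [bifurcationNhd]
  linarith

open SmoothedBilevel in
theorem mainTheorem9 {n m : ℕ} (f g : SmoothedBilevel.Vec n → SmoothedBilevel.Vec m → ℝ)
    (X : Set (SmoothedBilevel.Vec n)) (Y Y' : Set (SmoothedBilevel.Vec m))
    (y₀ : SmoothedBilevel.Vec m) (gLow gBar L Lf fBar d : ℝ)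
    (hstd : SmoothedBilevel.StandingAssumptions f g X Y y₀ gLow L)
    (hgBar : ∀ x ∈ X, g x y₀ ≤ gBar)
    (hLf : ∀ x ∈ X, ∀ x' ∈ X, ∀ y y' : SmoothedBilevel.Vec m, g x y ≤ g x y₀ →
      g x' y' ≤ g x' y₀ → |f x y - f x' y'| ≤ Lf * SmoothedBilevel.pairDist x x' y y')
    (hfBar : ∀ x ∈ X, ∀ y : SmoothedBilevel.Vec m, g x y ≤ g x y₀ → |f x y| ≤ fBar)
    (hY' : IsCompact Y') (hYY' : Y ⊆ interior Y')
    (hd : d = SmoothedBilevel.upperMinkowskiDim (SmoothedBilevel.bifurcationSet g X))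
    (hdn : d < n) :
    (∃ (μ : ℝ → ℝ) (α : ℝ → ℝ → ℝ), SmoothedBilevel.IsEigenvalueBound g X Y' μ ∧
      SmoothedBilevel.IsGradientBound g X Y Y' α) ∧
    ∃ C₁ C₂ : ℝ → ℝ,
      ∀ (run : SmoothedBilevel.Vec n → ℕ → SmoothedBilevel.Vec m)
        (ycd : SmoothedBilevel.Vec n → SmoothedBilevel.Vec m),
      (∀ z ∈ X, SmoothedBilevel.IsCubicNewtonRun L g y₀ z (run z)) →
      (∀ z ∈ X, SmoothedBilevel.IsCorrespondenceSolution f g z (run z) (ycd z)) →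
      MeasureTheory.volume {z | z ∈ X \ SmoothedBilevel.bifurcationSet g X ∧
        ¬ ContinuousWithinAt ycd X z} = 0 →
      ∀ (μ : ℝ → ℝ) (α : ℝ → ℝ → ℝ), SmoothedBilevel.IsEigenvalueBound g X Y' μ →
      SmoothedBilevel.IsGradientBound g X Y Y' α →
      ∀ (ξ ρ δ : ℝ) (K : ℕ), 0 < ξ → 0 < ρ → 0 < δ →
      SmoothedBilevel.iterBound₁ gBar gLow L (μ δ) (α δ (μ δ / (2 * L))) +
        SmoothedBilevel.iterBound₂ gBar gLow L (μ δ) ρ < K →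
      ∀ yhat : SmoothedBilevel.Vec n → SmoothedBilevel.Vec m,
      (∀ z ∈ X, SmoothedBilevel.IsCubicNewtonOutput L g z (run z) K (yhat z)) →
      MeasureTheory.AEStronglyMeasurable (fun z => f z (yhat z))
        (MeasureTheory.volume.restrict X) →
      ∀ x : SmoothedBilevel.Vec n,
        DifferentiableAt ℝ (SmoothedBilevel.gaussSmooth ξ
          (SmoothedBilevel.extendedValue f X fBar ycd)) x ∧
        MeasureTheory.Integrable (fun z => SmoothedBilevel.extendedValue f X fBar yhat z •
          gradient (SmoothedBilevel.gaussKernel ξ) (x - z)) ∧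
        ‖gradient (SmoothedBilevel.gaussSmooth ξ
            (SmoothedBilevel.extendedValue f X fBar ycd)) x -
          SmoothedBilevel.kernelGradIntegral ξ
            (SmoothedBilevel.extendedValue f X fBar yhat) x‖
          ≤ C₁ ξ * ρ + C₂ ξ * δ ^ (((n : ℝ) - d) / 2) := by
  subst hd
  obtain ⟨hbounds, C₁, C₂, hC⟩ := mainTheorem9_general (gLow := gLow) hstd.X_compact
    (hstd.f_continuous.mono fun p hp => ⟨hp.1, mem_univ _⟩) hstd.hasRegularFibers hstd.L_pos
    hstd.g_lower hgBar hstd.level_subset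
    (fun x hx y y' hy hy' => pairDist_self_left x y y' ▸ hLf x hx x hx y y' hy hy') hfBar
    hstd.Y_compact hY' hYY' hdn
  exact ⟨hbounds, C₁, C₂, fun run ycd hrun hycd => hC run ycd hrun fun z hz => (hycd z hz).1.1⟩
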